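/- **Theorem (minimax lower bound).** Let $r\ge 0$ and $K\ge 2$ be integers, let $\boldsymbol d=(d_0,\dots,d_{r+1})$ and $\boldsymbol t=(t_0,\dots,t_r)$ be vectors of integers with $d_{r+1}=1$, $t_i\ge 1$ and $t_i\le \min(d_0,\dots,d_i)$ for all $i=0,\dots,r$, and let $\boldsymbol\beta=(\beta_0,\dots,\beta_r)$ with all $\beta_i>0$. Put $$\beta_i^*=\beta_i\prod_{l=i+1}^r\min(\beta_l,1),\qquad \phi_n=\max_{i=0,\dots,r} n^{-\beta_i^*/(\beta_i^*+t_i)} .$$ For $\beta,Q>0$ and a cube $D=[a,b]^m$ let $\mathcal C^\beta(D,Q)$ be the set of functions $f:D\to\mathbb R$ whose partial derivatives up to order $\lfloor\beta\rfloor$ exist and that satisfy $$\sum_{|\boldsymbol\alpha|<\beta}\|\partial^{\boldsymbol\alpha}f\|_\infty+\sum_{|\boldsymbol\alpha|=\lfloor\beta\rfloor}\ \sup_{x,y\in D,\ x\ne y}\frac{|\partial^{\boldsymbol\alpha}f(x)-\partial^{\boldsymbol\alpha}f(y)|}{|x-y|_\infty^{\beta-\lfloor\beta\rfloor}}\le Q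 .$$ Let $\mathcal G(r,\boldsymbol d,\boldsymbol t,\boldsymbol\beta,Q)$ be the set of functions $g_r\circ\cdots\circ g_0:[0,1]^{d_0}\to\mathbb R$ with $g_i=(g_{ij})_j:[a_i,b_i]^{d_i}\to[a_{i+1},b_{i+1}]^{d_{i+1}}$ for some $|a_i|,|b_i|\le Q$, where $[a_0,b_0]=[0,1]$ and each $g_{ij}$ depends on at most $t_i$ of its variables and, as a function of $t_i$ variables, lies in $\mathcal C^{\beta_i}([a_i,b_i]^{t_i},Q)$. Let $\mathcal G'(r,\boldsymbol d,\boldsymbol t,\boldsymbol\beta,Q,K)$ be the set of functions $\boldsymbol\eta=(\eta_1,\dots,\eta_K)$ from $[0,1]^{d_0}$ to the probability simplex of $\mathbb R^K$ with $\eta_k\in\mathcal G(r,\boldsymbol d,\boldsymbol t,\boldsymbol\beta,Q)$ for all $k$. Let $P_{\boldsymbol X}$ be a probability distribution on $[0,1]^{d_0}$ with a Lebesgue density that takes values in $[\gamma,\Gamma]$, where $0<\gamma\le\Gamma<\infty$. Let $\boldsymbol X\sim P_{\boldsymbol X}$, let $\boldsymbol Y\in\{\boldsymbol e_1,\dots,\boldsymbol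 e_K\}$ with $\mathbb P(\boldsymbol Y=\boldsymbol e_k\mid \boldsymbol X=\boldsymbol x)=\eta_k(\boldsymbol x)$, and let $\mathcal D_n$ be an i.i.d. sample of size $n$ from the distribution of $(\boldsymbol X,\boldsymbol Y)$. For functions $\boldsymbol p,\boldsymbol q$ from $[0,1]^{d_0}$ to the simplex let $$R(\boldsymbol p,\boldsymbol q)=\mathbb E_{\boldsymbol X}\Big[\tfrac12\sum_{k=1}^K\big(\sqrt{p_k(\boldsymbol X)}-\sqrt{q_k(\boldsymbol X)}\big)^2\Big]$$ be the expected squared Hellinger distance. Then there is $Q_0>0$, depending only on $r,\boldsymbol d,\boldsymbol t,\boldsymbol\beta,K$, such that for every $Q\ge Q_0$ there is a constant $c>0$, depending only on $r,\boldsymbol d,\boldsymbol t,\boldsymbol\beta,Q,K,\gamma,\Gamma$, with $$\inf_{\hat{\boldsymbol p}_n}\ \sup_{\boldsymbol\eta\in\mathcal G'(r,\boldsymbol d,\boldsymbol t,\boldsymbol\beta,Q,K)}\mathbb E_{\mathcal D_n}\big[R(\hat{\boldsymbol p}_n,\boldsymbol\eta)\big]\ \ge\ c\,\phi_n\qquad\text{for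 all } n\ge 1,$$ where the infimum is over all estimators, that is, over all (jointly measurable) maps of the sample and the point $\boldsymbol x$ into the probability simplex. -/

import Mathlib

open MeasureTheory
open scoped ENNReal

noncomputable section

namespace CompositeClassification

/-- The cube `[a, b]^m`. -/
def cube (m : ℕ) (a b : ℝ) : Set (Fin m → ℝ) := Set.Icc (fun _ => a) (fun _ => b)

/-- `D α` is the partial derivative `∂^α f` on the cube `[a, b]^m` for every multi-index `α` of
order at most `s` (one-sided at the faces of the cube). -/
def IsPartialDerivFamily {m : ℕ} (a b : ℝ) (s : ℕ) (f : (Fin m → ℝ) → ℝ)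
    (D : (Fin m → ℕ) → (Fin m → ℝ) → ℝ) : Prop :=
  (∀ x ∈ cube m a b, D 0 x = f x) ∧
  ∀ α : Fin m → ℕ, ∑ l, α l < s → ∀ j : Fin m, ∀ x ∈ cube m a b,
    HasDerivWithinAt (fun u : ℝ => D α (Function.update x j u)) (D (α + Pi.single j 1) x)
      (Set.Icc a b) (x j)

/-- The Hölder ball `C^β([a, b]^m, Q)`: the sum of the sup norms of `∂^α f` over `|α| < β`, plus
the sum over `|α| = ⌊β⌋` of the `(β - ⌊β⌋)`-Hölder seminorms of `∂^α f` with respect to the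
maximum norm (the norm of `Fin m → ℝ`), is at most `Q`. The suprema are taken in `[0, ∞]`;
`k ∈ Finset.range ⌈β⌉₊` says `k < β`, and `Finset.piAntidiag Finset.univ k` is the set of
multi-indices of order `k`. -/
def holderBall (m : ℕ) (β a b Q : ℝ) : Set ((Fin m → ℝ) → ℝ) :=
  {f | ∃ D : (Fin m → ℕ) → (Fin m → ℝ) → ℝ,
    IsPartialDerivFamily a b ⌊β⌋₊ f D ∧
    (∑ k ∈ Finset.range ⌈β⌉₊, ∑ α ∈ Finset.piAntidiag (Finset.univ : Finset (Fin m)) k,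
        ⨆ x ∈ cube m a b, ENNReal.ofReal |D α x|) +
      (∑ α ∈ Finset.piAntidiag (Finset.univ : Finset (Fin m)) ⌊β⌋₊,
        ⨆ x ∈ cube m a b, ⨆ y ∈ cube m a b, ⨆ _ : x ≠ y,
          ENNReal.ofReal (|D α x - D α y| / ‖x - y‖ ^ (β - (⌊β⌋₊ : ℝ))))
      ≤ ENNReal.ofReal Q}

/-- The composition of the layers `g_0, g_1, …`: `compLayers g x i = (g_{i-1} ∘ ⋯ ∘ g_0) x`. -/
def compLayers {r : ℕ} {d : Fin (r + 2) → ℕ}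
    (g : (i : Fin (r + 1)) → (Fin (d i.castSucc) → ℝ) → (Fin (d i.succ) → ℝ))
    (x : Fin (d 0) → ℝ) (i : Fin (r + 2)) : Fin (d i) → ℝ :=
  Fin.induction (motive := fun i => Fin (d i) → ℝ) x (fun i y => g i y) i

/-- The class `G(r, d, t, β, Q)` of functions `g_r ∘ ⋯ ∘ g_0` on `[0, 1]^{d_0}` with
`g_i : [a_i, b_i]^{d_i} → [a_{i+1}, b_{i+1}]^{d_{i+1}}`, where every component `g_{ij}` is a
function of `t_i` of the `d_i` variables and as such lies in `C^{β_i}([a_i, b_i]^{t_i}, Q)`, and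
`|a_i|, |b_i| ≤ Q`. The last dimension `d_{r+1}` is `1`, so the functions are real-valued. Only
the values on `[0, 1]^{d_0}` matter. -/
def compClass (r : ℕ) (d : Fin (r + 2) → ℕ) (t : Fin (r + 1) → ℕ) (β : Fin (r + 1) → ℝ)
    (Q : ℝ) : Set ((Fin (d 0) → ℝ) → ℝ) :=
  {f | ∃ (a b : Fin (r + 2) → ℝ)
      (g : (i : Fin (r + 1)) → (Fin (d i.castSucc) → ℝ) → (Fin (d i.succ) → ℝ)),
    a 0 = 0 ∧ b 0 = 1 ∧ (∀ i, |a i| ≤ Q ∧ |b i| ≤ Q) ∧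
    (∀ i : Fin (r + 1), Set.MapsTo (g i)
      (cube (d i.castSucc) (a i.castSucc) (b i.castSucc))
      (cube (d i.succ) (a i.succ) (b i.succ))) ∧
    (∀ (i : Fin (r + 1)) (j : Fin (d i.succ)),
      ∃ ι : Fin (t i) ↪ Fin (d i.castSucc),
      ∃ h ∈ holderBall (t i) (β i) (a i.castSucc) (b i.castSucc) Q,
        ∀ x ∈ cube (d i.castSucc) (a i.castSucc) (b i.castSucc), g i x j = h (x ∘ ι)) ∧
    ∀ x ∈ cube (d 0) 0 1, compLayers g x (Fin.last (r + 1)) = fun _ => f x}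

/-- The class `G'(r, d, t, β, Q, K)` of conditional class probabilities. -/
def condProbClass (r : ℕ) (d : Fin (r + 2) → ℕ) (t : Fin (r + 1) → ℕ) (β : Fin (r + 1) → ℝ)
    (Q : ℝ) (K : ℕ) : Set ((Fin (d 0) → ℝ) → Fin K → ℝ) :=
  {η | (∀ x ∈ cube (d 0) 0 1, η x ∈ stdSimplex ℝ (Fin K)) ∧
    ∀ k, (fun x => η x k) ∈ compClass r d t β Q}

/-- The squared Hellinger distance of two probability vectors. -/
def hellingerSq {K : ℕ} (p q : Fin K → ℝ) : ℝ :=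
  (1 / 2) * ∑ k, (√(p k) - √(q k)) ^ 2

/-- The risk `R(η, p) = E_X[H²(η(X), p(X))]`. -/
def hellingerRisk {m K : ℕ} (PX : Measure (Fin m → ℝ)) (η p : (Fin m → ℝ) → Fin K → ℝ) : ℝ≥0∞ :=
  ∫⁻ x, ENNReal.ofReal (hellingerSq (η x) (p x)) ∂PX

/-- `PX` is a distribution on `[0, 1]^m` that has a Lebesgue density with values in `[γ, Γ]`. -/
def HasDensityBetween {m : ℕ} (PX : Measure (Fin m → ℝ)) (γ Γ : ℝ) : Prop :=
  IsProbabilityMeasure PX ∧ ∃ q : (Fin m → ℝ) → ℝ, Measurable q ∧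
    (∀ x ∈ cube m 0 1, γ ≤ q x ∧ q x ≤ Γ) ∧
    PX = (volume.restrict (cube m 0 1)).withDensity (fun x => ENNReal.ofReal (q x))

/-- The joint distribution of `(X, Y)` when `X ∼ PX` and `Y` is the label `k` with conditional
probability `η_k(X)`; the label `e_k` is coded by `k : Fin K`. -/
def jointLaw {m K : ℕ} (PX : Measure (Fin m → ℝ)) (η : (Fin m → ℝ) → Fin K → ℝ) :
    Measure ((Fin m → ℝ) × Fin K) :=
  ∑ k, (PX.withDensity (fun x => ENNReal.ofReal (η x k))).map (fun x => (x, k))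

/-- The estimators of the conditional class probabilities from a sample of size `n`: jointly
measurable functions of the sample and of the point `x`, with probability vectors as values. -/
def estimators (m K n : ℕ) :
    Set ((Fin n → (Fin m → ℝ) × Fin K) → (Fin m → ℝ) → Fin K → ℝ) :=
  {p | Measurable (Function.uncurry p) ∧ ∀ D x, p D x ∈ stdSimplex ℝ (Fin K)}

/-- The minimax risk: the infimum over all estimators of the supremum over `η ∈ G` of the expected
risk, for an i.i.d. sample of size `n` from the joint distribution given by `η`. -/
def minimaxRisk {m K : ℕ} (PX : Measure (Fin m → ℝ)) (G : Set ((Fin m → ℝ) → Fin K → ℝ))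
    (n : ℕ) : ℝ≥0∞ :=
  ⨅ p ∈ estimators m K n, ⨆ η ∈ G,
    ∫⁻ D, hellingerRisk PX η (p D) ∂(Measure.pi fun _ : Fin n => jointLaw PX η)

/-- `β_i^* = β_i ∏_{l > i} min(β_l, 1)`. -/
def effSmoothness {r : ℕ} (β : Fin (r + 1) → ℝ) (i : Fin (r + 1)) : ℝ :=
  β i * ∏ l ∈ Finset.Ioi i, min (β l) 1

/-- `φ_n = max_i n^{-β_i^* / (β_i^* + t_i)}`. -/
def rate {r : ℕ} (t : Fin (r + 1) → ℕ) (β : Fin (r + 1) → ℝ) (n : ℕ) : ℝ :=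
  Finset.univ.sup' Finset.univ_nonempty fun i : Fin (r + 1) =>
    (n : ℝ) ^ (-(effSmoothness β i / (effSmoothness β i + t i)))

end CompositeClassification

end

namespace CompositeClassification

/-! It suffices to treat one layer `i` at a time: the rate is a maximum over layers, so the smallest
constant and the largest `Q₀` serve for all of them. Divide the first `t i` coordinates into a grid
of width `1 / M` and place on each cell either nothing or a smooth bump of height `M ^ (-β i)`;
these sums are `β i`-Hölder uniformly in `M` (`holderBound_bumpSum`). The layers after `i` apply the
powers `min (β l) 1`, so the height becomes `ε = M ^ (-effSmoothness β i)`
(`affine_rpow_mem_compClass`). Let the result be the probability of label `0`, and give the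
remaining mass to label `1`.

The hypotheses lie at the boundary of the simplex. There the squared Hellinger distance between `0`
and `ε` is of order `ε`, not `ε ^ 2`, whereas label `0` is seen in a given cell only with
probability of order `ε * M ^ (-t i)`. If `n * ε * M ^ (-t i)` is small, the sample cannot tell
whether the bump is there. Each of the `M ^ t i` cells then costs about `ε * M ^ (-t i)`, in total
about `ε`. Taking `M` of order `n ^ (1 / (effSmoothness β i + t i))` gives the rate.

The statistical part is an Assouad argument (`le_minimaxRisk_of_cells`). Two hypotheses that differ
in one cell have a common minorant, a subprobability whose `n`-fold product keeps mass at least `1 /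
2`; integration against it replaces total variation and likelihood ratios. -/

/-! ### Assouad's lemma through common minorants. -/

/-- The product measure is monotone in its factor. -/
theorem pi_measure_mono {ι α : Type*} [Fintype ι] [MeasurableSpace α] {μ ν : Measure α}
    [SigmaFinite μ] [SigmaFinite ν] (h : μ ≤ ν) :
    Measure.pi (fun _ : ι => μ) ≤ Measure.pi (fun _ : ι => ν) := by
  -- The product outer measure is the largest one bounded by the product on boxes, so only boxes
  -- have to be compared.
  have key : (Measure.pi (fun _ : ι => μ)).toOuterMeasure ≤
      OuterMeasure.pi fun _ : ι => ν.toOuterMeasure := by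
    rw [OuterMeasure.le_pi]
    intro s _
    change Measure.pi (fun _ : ι => μ) (Set.pi Set.univ s) ≤ ∏ i, ν (s i)
    rw [Measure.pi_pi]
    exact Finset.prod_le_prod' fun i _ => h (s i)
  refine Measure.le_iff.2 fun s hs => (key s).trans ?_
  rw [Measure.pi, toMeasure_apply _ _ hs]

variable {m K : ℕ}

/-- Label `0` gets the value of `F`, label `1` that of `G`, all other labels get `0`. -/
def twoLabel {X : Type*} (K : ℕ) (F G : X → ℝ) : X → Fin K → ℝ := fun x k =>
  if k.val = 0 then F x else if k.val = 1 then G x else 0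

/-- Serves to compare true laws with a minorant: the weights need not sum to one. -/
theorem jointLaw_mono (PX : Measure (Fin m → ℝ)) {η η' : (Fin m → ℝ) → Fin K → ℝ}
    (h : ∀ x k, η x k ≤ η' x k) : jointLaw PX η ≤ jointLaw PX η' := by
  unfold jointLaw
  refine Finset.sum_le_sum fun k _ => Measure.map_mono ?_ (by fun_prop)
  exact withDensity_mono (Filter.Eventually.of_forall fun x => ENNReal.ofReal_le_ofReal (h x k))

theorem jointLaw_univ (PX : Measure (Fin m → ℝ)) (η : (Fin m → ℝ) → Fin K → ℝ) :
    jointLaw PX η Set.univ = ∑ k, ∫⁻ x, ENNReal.ofReal (η x k) ∂PX := by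
  unfold jointLaw
  rw [Measure.finsetSum_apply]
  refine Finset.sum_congr rfl fun k _ => ?_
  rw [Measure.map_apply (by fun_prop) MeasurableSet.univ]
  simp

theorem jointLaw_twoLabel_univ (hK : 2 ≤ K) (PX : Measure (Fin m → ℝ)) (F G : (Fin m → ℝ) → ℝ) :
    jointLaw PX (twoLabel K F G) Set.univ =
      ∫⁻ x, ENNReal.ofReal (F x) ∂PX + ∫⁻ x, ENNReal.ofReal (G x) ∂PX := by
  obtain ⟨K, rfl⟩ : ∃ L, K = L + 2 := ⟨K - 2, by omega⟩
  rw [jointLaw_univ, Fin.sum_univ_succ, Fin.sum_univ_succ]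
  simp [twoLabel]

/-- Averaging over the Boolean cube, coordinate by coordinate. -/
theorem le_sum_of_update_add_update {U : Type*} [Fintype U] [DecidableEq U]
    (A : (U → Bool) → U → ℝ≥0∞) (v S : ℝ≥0∞)
    (h : ∀ w u, v ≤ A (Function.update w u false) u + A (Function.update w u true) u)
    (hS : ∀ w, ∑ u, A w u ≤ S) : Fintype.card U * v ≤ 2 * S := by
  -- Flipping coordinate `u` is an involution of the Boolean cube, and the two summands are the
  -- values at `w` and at its flip.
  have hflip : ∀ u, ∑ w, (A (Function.update w u false) u + A (Function.update w u true) u)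
      = 2 * ∑ w, A w u := by
    intro u
    have inv : Function.Involutive fun w : U → Bool => Function.update w u (!w u) := by
      intro w
      simp
    have h2 : ∑ w, A (Function.update w u (!w u)) u = ∑ w, A w u :=
      Equiv.sum_comp inv.toPerm fun w => A w u
    rw [two_mul]
    nth_rewrite 2 [← h2]
    rw [← Finset.sum_add_distrib]
    refine Finset.sum_congr rfl fun w _ => ?_
    have hw : Function.update w u (w u) = w := Function.update_eq_self u w
    cases hwu : w u
    · rw [hwu] at hw; simp [hw]
    · rw [hwu] at hw; simp [hw, add_comm]
  have h1 : (Fintype.card (U → Bool) : ℝ≥0∞) * (Fintype.card U * v) ≤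
      Fintype.card (U → Bool) * (2 * S) := by
    calc (Fintype.card (U → Bool) : ℝ≥0∞) * (Fintype.card U * v)
        = ∑ u : U, ∑ w : U → Bool, v := by
          simp only [Finset.sum_const, Finset.card_univ, nsmul_eq_mul]; ring
      _ ≤ ∑ u : U, 2 * ∑ w, A w u :=
          Finset.sum_le_sum fun u _ => (Finset.sum_le_sum fun w _ => h w u).trans (hflip u).le
      _ = 2 * ∑ w, ∑ u, A w u := by rw [← Finset.mul_sum, Finset.sum_comm]
      _ ≤ 2 * ∑ w : U → Bool, S := by gcongr with w; exact hS w
      _ = _ := by simp only [Finset.sum_const, Finset.card_univ, nsmul_eq_mul]; ring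
  exact (ENNReal.mul_le_mul_iff_right (by simp) (ENNReal.natCast_ne_top _)).1 h1

theorem isFiniteMeasure_jointLaw {PX : Measure (Fin m → ℝ)} [IsProbabilityMeasure PX]
    {η : (Fin m → ℝ) → Fin K → ℝ} (h : ∀ x k, η x k ≤ 1) : IsFiniteMeasure (jointLaw PX η) := by
  refine ⟨?_⟩
  rw [jointLaw_univ]
  refine ENNReal.sum_lt_top.2 fun k _ => ?_
  calc ∫⁻ x, ENNReal.ofReal (η x k) ∂PX ≤ ∫⁻ _, 1 ∂PX :=
        lintegral_mono fun x => ENNReal.ofReal_le_one.2 (h x k)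
    _ < ⊤ := by simp

/-- Assouad's lemma for the Hellinger risk of conditional class probabilities that vanish or are
of size `ε` on each of finitely many cells. -/
theorem le_minimaxRisk_of_cells {n : ℕ} (hK : 2 ≤ K) (PX : Measure (Fin m → ℝ))
    [IsProbabilityMeasure PX] {U : Type*} [Fintype U] [DecidableEq U]
    (F : (U → Bool) → (Fin m → ℝ) → ℝ) (C I : U → Set (Fin m → ℝ)) {ε δ κ : ℝ}
    (hε0 : 0 ≤ ε) (hε1 : ε ≤ 1) (hδ : 0 ≤ δ) (hκ : 0 ≤ κ) (hFm : ∀ w, Measurable (F w))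
    (hF0 : ∀ w x, 0 ≤ F w x) (hF1 : ∀ w x, F w x ≤ ε)
    (hmono : ∀ w u x, F (Function.update w u false) x ≤ F (Function.update w u true) x)
    (hoff : ∀ w u, ∀ x ∉ C u, F (Function.update w u false) x = F (Function.update w u true) x)
    (hon : ∀ w u, ∀ x ∈ I u, F w x = if w u then ε else 0)
    (hCm : ∀ u, MeasurableSet (C u)) (hIm : ∀ u, MeasurableSet (I u))
    (hdisj : Pairwise (Function.onFun Disjoint I)) (hC : ∀ u, PX (C u) ≤ ENNReal.ofReal κ)
    (hI : ∀ u, ENNReal.ofReal δ ≤ PX (I u)) (hn : n * (ε * κ) ≤ 1 / 2) (hn1 : 1 ≤ n)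
    (G : Set ((Fin m → ℝ) → Fin K → ℝ))
    (hG : ∀ w, twoLabel K (F w) (fun x => 1 - F w x) ∈ G) :
    ENNReal.ofReal (Fintype.card U * (ε * δ) / 16) ≤ minimaxRisk PX G n := by
  unfold minimaxRisk
  refine le_iInf₂ fun p hp => ?_
  set S := ⨆ η ∈ G, ∫⁻ D, hellingerRisk PX η (p D) ∂(Measure.pi fun _ : Fin n => jointLaw PX η)
    with hS
  set k0 : Fin K := ⟨0, by omega⟩ with hk0
  -- The label-`0` term of the Hellinger loss when the true probability is `ε` or `0`. Dropping the
  -- other labels only lowers the loss.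
  set ℓ : Bool → (Fin n → (Fin m → ℝ) × Fin K) → (Fin m → ℝ) → ℝ≥0∞ := fun c D x =>
    ENNReal.ofReal (1 / 2 * (√(if c then ε else 0) - √(p D x k0)) ^ 2) with hℓ
  have hpm : Measurable fun z : (Fin n → (Fin m → ℝ) × Fin K) × (Fin m → ℝ) =>
      p z.1 z.2 k0 := (measurable_pi_apply k0).comp hp.1
  have hℓm : ∀ c, Measurable (Function.uncurry (ℓ c)) := by
    intro c
    simp only [hℓ, Function.uncurry_def]
    fun_prop
  have hLm : ∀ c u, Measurable fun D => ∫⁻ x in I u, ℓ c D x ∂PX := fun c u =>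
    (hℓm c).lintegral_prod_right'
  set η : (U → Bool) → (Fin m → ℝ) → Fin K → ℝ := fun w =>
    twoLabel K (F w) (fun x => 1 - F w x) with hη
  have hη1 : ∀ w x k, η w x k ≤ 1 := by
    intro w x k
    have := hF0 w x
    have := hF1 w x
    simp only [hη, twoLabel]
    split_ifs <;> linarith
  set A : (U → Bool) → U → ℝ≥0∞ := fun w u =>
    ∫⁻ D, ∫⁻ x in I u, ℓ (w u) D x ∂PX ∂(Measure.pi fun _ : Fin n => jointLaw PX (η w)) with hA
  have hAS : ∀ w, ∑ u, A w u ≤ S := by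
    intro w
    refine le_trans ?_ (le_iSup₂ (f := fun η (_ : η ∈ G) => ∫⁻ D, hellingerRisk PX η (p D)
      ∂(Measure.pi fun _ : Fin n => jointLaw PX η)) (η w) (hG w))
    rw [← lintegral_finsetSum _ fun u _ => hLm (w u) u]
    refine lintegral_mono fun D => ?_
    have e1 : ∀ u, ∫⁻ x in I u, ℓ (w u) D x ∂PX =
        ∫⁻ x in I u, ENNReal.ofReal (1 / 2 * (√(η w x k0) - √(p D x k0)) ^ 2) ∂PX := by
      intro u
      refine setLIntegral_congr_fun (hIm u) fun x hx => ?_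
      simp [hℓ, hη, twoLabel, hk0, hon w u x hx]
    simp only [e1]
    rw [← tsum_fintype (L := .unconditional _), ← lintegral_iUnion hIm hdisj]
    refine (setLIntegral_le_lintegral _ _).trans (lintegral_mono fun x => ?_)
    refine ENNReal.ofReal_le_ofReal ?_
    unfold hellingerSq
    refine mul_le_mul_of_nonneg_left ?_ (by norm_num)
    exact Finset.single_le_sum (f := fun k => (√(η w x k) - √(p D x k)) ^ 2)
      (fun k _ => sq_nonneg _) (Finset.mem_univ k0)
  have hpair : ∀ w u, ENNReal.ofReal (ε * δ / 8) ≤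
      A (Function.update w u false) u + A (Function.update w u true) u := by
    intro w u
    set w0 := Function.update w u false with hw0
    set w1 := Function.update w u true with hw1
    -- The common minorant: on each label the smaller of the two weights.
    set ν := jointLaw PX (twoLabel K (F w0) (fun x => 1 - F w1 x)) with hν
    have := isFiniteMeasure_jointLaw (PX := PX) (hη1 w0)
    have := isFiniteMeasure_jointLaw (PX := PX) (hη1 w1)
    have hν0 : ν ≤ jointLaw PX (η w0) := jointLaw_mono PX fun x k => by
      have := hmono w u x
      simp only [hη, twoLabel]
      split_ifs <;> linarith
    have hν1 : ν ≤ jointLaw PX (η w1) := jointLaw_mono PX fun x k => by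
      have := hmono w u x
      simp only [hη, twoLabel]
      split_ifs <;> linarith
    have : IsFiniteMeasure ν := isFiniteMeasure_of_le _ hν0
    have hmass : ENNReal.ofReal (1 - ε * κ) ≤ ν Set.univ := by
      rw [hν, jointLaw_twoLabel_univ hK,
        ENNReal.ofReal_sub _ (mul_nonneg hε0 hκ), tsub_le_iff_right, ENNReal.ofReal_one]
      -- The two weights add up to one off `C u` and miss at most `ε` on it.
      calc (1 : ℝ≥0∞) = ∫⁻ _, 1 ∂PX := by simp
        _ ≤ ∫⁻ x, (ENNReal.ofReal (F w0 x) + ENNReal.ofReal (1 - F w1 x)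
              + (C u).indicator (fun _ => ENNReal.ofReal ε) x) ∂PX := by
            refine lintegral_mono fun x => ?_
            have h0 := hF0 w0 x
            have h1 := hF1 w1 x
            by_cases hx : x ∈ C u
            · rw [Set.indicator_of_mem hx, ← ENNReal.ofReal_add h0 (by linarith),
                ← ENNReal.ofReal_add (by linarith) hε0]
              exact ENNReal.one_le_ofReal.2 (by linarith)
            · rw [Set.indicator_of_notMem hx, ← ENNReal.ofReal_add h0 (by linarith), add_zero,
                hoff w u x hx]
              exact ENNReal.one_le_ofReal.2 (by linarith)
        _ = ∫⁻ x, ENNReal.ofReal (F w0 x) ∂PX + ∫⁻ x, ENNReal.ofReal (1 - F w1 x) ∂PX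
              + ENNReal.ofReal ε * PX (C u) := by
            have := hFm w0
            have := hFm w1
            rw [lintegral_add_right _ (measurable_const.indicator (hCm u)),
              lintegral_add_right _ (by fun_prop), lintegral_indicator_const (hCm u)]
        _ ≤ _ := by
            rw [ENNReal.ofReal_mul hε0]
            gcongr
            exact hC u
    have hn' : (1 : ℝ) ≤ n := by exact_mod_cast hn1
    have hεκ : ε * κ ≤ 1 / 2 := by nlinarith [mul_nonneg hε0 hκ]
    have hmassn : ENNReal.ofReal (1 / 2) ≤ Measure.pi (fun _ : Fin n => ν) Set.univ := by
      rw [Measure.pi_univ, Finset.prod_const, Finset.card_univ, Fintype.card_fin]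
      refine le_trans ?_ (pow_le_pow_left₀ zero_le hmass n)
      rw [← ENNReal.ofReal_pow (by linarith)]
      refine ENNReal.ofReal_le_ofReal ?_
      -- Bernoulli: `(1 - ε * κ) ^ n ≥ 1 - n * (ε * κ) ≥ 1 / 2`.
      have := one_add_mul_le_pow (a := -(ε * κ)) (by linarith) n
      rw [← sub_eq_add_neg] at this
      linarith
    have hsum : ∀ D, ENNReal.ofReal (ε * δ / 4) ≤
        ∫⁻ x in I u, ℓ false D x ∂PX + ∫⁻ x in I u, ℓ true D x ∂PX := by
      intro D
      have hm : Measurable (ℓ true D) := (hℓm true).of_uncurry_left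
      rw [← lintegral_add_right _ hm]
      calc ENNReal.ofReal (ε * δ / 4) = ENNReal.ofReal (ε / 4) * ENNReal.ofReal δ := by
            rw [← ENNReal.ofReal_mul (by positivity)]; ring_nf
        _ ≤ ENNReal.ofReal (ε / 4) * PX (I u) := by gcongr; exact hI u
        _ = ∫⁻ _ in I u, ENNReal.ofReal (ε / 4) ∂PX := by simp
        _ ≤ _ := by
            refine lintegral_mono fun x => ?_
            simp only [hℓ]
            rw [← ENNReal.ofReal_add (by positivity) (by positivity)]
            refine ENNReal.ofReal_le_ofReal ?_
            have hs : √ε ^ 2 = ε := Real.sq_sqrt hε0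
            simp only [Bool.false_eq_true, if_false, if_true, Real.sqrt_zero]
            -- With `q` the square root of the estimate, `q ^ 2 + (√ε - q) ^ 2 = ε / 2 + (√ε - 2 *
            -- q) ^ 2 / 2`: no estimate is close to both `0` and `ε`.
            nlinarith [sq_nonneg (√ε - 2 * √(p D x k0))]
    calc ENNReal.ofReal (ε * δ / 8) = ENNReal.ofReal (ε * δ / 4) * ENNReal.ofReal (1 / 2) := by
          rw [← ENNReal.ofReal_mul (by positivity)]; ring_nf
      _ ≤ ENNReal.ofReal (ε * δ / 4) * Measure.pi (fun _ : Fin n => ν) Set.univ := by gcongr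
      _ = ∫⁻ _, ENNReal.ofReal (ε * δ / 4) ∂(Measure.pi fun _ : Fin n => ν) := by simp
      _ ≤ ∫⁻ D, (∫⁻ x in I u, ℓ false D x ∂PX + ∫⁻ x in I u, ℓ true D x ∂PX)
            ∂(Measure.pi fun _ : Fin n => ν) := lintegral_mono hsum
      _ = ∫⁻ D, ∫⁻ x in I u, ℓ false D x ∂PX ∂(Measure.pi fun _ : Fin n => ν)
          + ∫⁻ D, ∫⁻ x in I u, ℓ true D x ∂PX ∂(Measure.pi fun _ : Fin n => ν) :=
          lintegral_add_right _ (hLm true u)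
      _ ≤ _ := by
          simp only [hA, hw0, hw1, Function.update_self]
          exact add_le_add (lintegral_mono' (pi_measure_mono hν0) le_rfl)
            (lintegral_mono' (pi_measure_mono hν1) le_rfl)
  have hfin := le_sum_of_update_add_update A _ S hpair hAS
  have h2 : 2 * ENNReal.ofReal (Fintype.card U * (ε * δ) / 16) =
      Fintype.card U * ENNReal.ofReal (ε * δ / 8) := by
    rw [← ENNReal.ofReal_natCast, ← ENNReal.ofReal_mul (by positivity),
      ← ENNReal.ofReal_ofNat 2, ← ENNReal.ofReal_mul (by norm_num)]
    ring_nf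
  rw [← h2] at hfin
  exact (ENNReal.mul_le_mul_iff_right (by simp) (by simp)).1 hfin

/-! ### Hölder bounds on the unit cube. -/

/-- The derivatives of `f` up to order `⌊β⌋` and the Hölder quotients of those of order `⌊β⌋` are
bounded by `C` on the unit cube. -/
def HolderBound (m : ℕ) (β C : ℝ) (f : (Fin m → ℝ) → ℝ) : Prop :=
  ∃ D : (Fin m → ℕ) → (Fin m → ℝ) → ℝ, IsPartialDerivFamily 0 1 ⌊β⌋₊ f D ∧
    (∀ α, ∑ l, α l ≤ ⌊β⌋₊ → ∀ x ∈ cube m 0 1, |D α x| ≤ C) ∧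
    ∀ α, ∑ l, α l = ⌊β⌋₊ → ∀ x ∈ cube m 0 1, ∀ y ∈ cube m 0 1,
      |D α x - D α y| ≤ C * ‖x - y‖ ^ (β - (⌊β⌋₊ : ℝ))

/-- The number of terms in the Hölder norm. -/
noncomputable def holderTerms (m : ℕ) (β : ℝ) : ℕ :=
  ∑ k ∈ Finset.range ⌈β⌉₊, (Finset.piAntidiag (Finset.univ : Finset (Fin m)) k).card +
    (Finset.piAntidiag (Finset.univ : Finset (Fin m)) ⌊β⌋₊).card

theorem HolderBound.mem_holderBall {m : ℕ} {β C Q : ℝ} {f : (Fin m → ℝ) → ℝ}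
    (hf : HolderBound m β C f) (hQ : holderTerms m β * C ≤ Q) :
    f ∈ holderBall m β 0 1 Q := by
  obtain ⟨D, hD, hb, hh⟩ := hf
  refine ⟨D, hD, le_trans ?_ (ENNReal.ofReal_le_ofReal hQ)⟩
  have hcast : ENNReal.ofReal (holderTerms m β * C) =
      ∑ k ∈ Finset.range ⌈β⌉₊, ∑ _α ∈ Finset.piAntidiag (Finset.univ : Finset (Fin m)) k,
        ENNReal.ofReal C +
      ∑ _α ∈ Finset.piAntidiag (Finset.univ : Finset (Fin m)) ⌊β⌋₊, ENNReal.ofReal C := by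
    simp only [Finset.sum_const, nsmul_eq_mul]
    rw [← Finset.sum_mul, ← add_mul, ENNReal.ofReal_mul (by positivity),
      ENNReal.ofReal_natCast, holderTerms]
    push_cast
    rfl
  rw [hcast]
  refine add_le_add (Finset.sum_le_sum fun k hk => Finset.sum_le_sum fun α hα => ?_)
    (Finset.sum_le_sum fun α hα => ?_)
  · have hk' : k ≤ ⌊β⌋₊ := by
      have h1 : (k : ℝ) < β := Nat.lt_ceil.1 (Finset.mem_range.1 hk)
      exact Nat.le_floor h1.le
    refine iSup₂_le fun x hx => ENNReal.ofReal_le_ofReal (hb α ?_ x hx)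
    rw [(Finset.mem_piAntidiag.1 hα).1]
    exact hk'
  · refine iSup₂_le fun x hx => iSup₂_le fun y hy => iSup_le fun hxy =>
      ENNReal.ofReal_le_ofReal ?_
    have hpos : 0 < ‖x - y‖ := norm_pos_iff.2 (sub_ne_zero.2 hxy)
    rw [div_le_iff₀ (Real.rpow_pos_of_pos hpos _)]
    exact hh α (Finset.mem_piAntidiag.1 hα).1 x hx y hy

theorem HolderBound.affine {m : ℕ} {β C : ℝ} {f : (Fin m → ℝ) → ℝ} (hf : HolderBound m β C f)
    {a b : ℝ} (ha : |a| ≤ 1) (hb : |b| ≤ 1) :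
    HolderBound m β (C + 1) fun x => a + b * f x := by
  obtain ⟨D, ⟨hD0, hD⟩, hbd, hh⟩ := hf
  refine ⟨fun α x => (if α = 0 then a else 0) + b * D α x, ⟨fun x hx => ?_, ?_⟩, ?_, ?_⟩
  · simp [hD0 x hx]
  · intro α hα j x hx
    have h1 : α + Pi.single j 1 ≠ 0 := fun h => by simpa using congrFun h j
    simp only [if_neg h1, zero_add]
    exact ((hD α hα j x hx).const_mul b).const_add _
  · intro α hα x hx
    have h1 : |if α = 0 then a else 0| ≤ 1 := by split_ifs <;> simp [ha]
    calc _ ≤ |if α = 0 then a else 0| + |b| * |D α x| := by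
          rw [← abs_mul]; exact abs_add_le _ _
      _ ≤ 1 + 1 * |D α x| := by gcongr
      _ ≤ C + 1 := by linarith [hbd α hα x hx]
  · intro α hα x hx y hy
    rw [add_sub_add_left_eq_sub, ← mul_sub, abs_mul]
    have := hh α hα x hx y hy
    have h0 : 0 ≤ ‖x - y‖ ^ (β - (⌊β⌋₊ : ℝ)) := by positivity
    calc _ ≤ 1 * |D α x - D α y| := by gcongr
      _ ≤ _ := by linarith

theorem norm_sub_le_one_of_mem_cube {m : ℕ} {x y : Fin m → ℝ} (hx : x ∈ cube m 0 1)
    (hy : y ∈ cube m 0 1) : ‖x - y‖ ≤ 1 := by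
  refine (pi_norm_le_iff_of_nonneg zero_le_one).2 fun l => ?_
  have h1 := hx.1 l
  have h2 := hx.2 l
  have h3 := hy.1 l
  have h4 := hy.2 l
  simp only [Pi.sub_apply, Real.norm_eq_abs]
  exact abs_le.2 ⟨by simp only at *; linarith, by simp only at *; linarith⟩

/-- Subadditivity of the power, applied to `a = b + (a - b)`. -/
theorem abs_rpow_sub_rpow_le {p a b : ℝ} (ha : 0 ≤ a) (hb : 0 ≤ b) (hp : 0 ≤ p) (hp1 : p ≤ 1) :
    |a ^ p - b ^ p| ≤ |a - b| ^ p := by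
  wlog h : b ≤ a generalizing a b
  · rw [abs_sub_comm, abs_sub_comm a b]
    exact this hb ha (le_of_not_ge h)
  have h1 := Real.rpow_add_le_add_rpow hb (sub_nonneg.2 h) hp hp1
  rw [add_sub_cancel] at h1
  rw [abs_of_nonneg (sub_nonneg.2 h),
    abs_of_nonneg (sub_nonneg.2 (Real.rpow_le_rpow hb h hp))]
  linarith

/-- Powers of a coordinate with exponent between `min β 1` and `1` are `β`-Hölder. -/
theorem holderBound_coord_rpow {m : ℕ} {β p : ℝ} (hβ : 0 < β) (hp : min β 1 ≤ p) (hp1 : p ≤ 1)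
    (k : Fin m) : HolderBound m β 1 fun x => x k ^ p := by
  have hp0 : 0 < p := lt_of_lt_of_le (by positivity) hp
  have hcoord : ∀ x ∈ cube m 0 1, 0 ≤ x k ∧ x k ≤ 1 := fun x hx => ⟨hx.1 k, hx.2 k⟩
  rcases lt_or_ge β 1 with hβ1 | hβ1
  · have hfl : ⌊β⌋₊ = 0 := Nat.floor_eq_zero.2 hβ1
    refine ⟨fun _ x => x k ^ p, ⟨fun x _ => rfl, ?_⟩, ?_, ?_⟩
    · intro α hα
      simp [hfl] at hα
    · intro α _ x hx
      rw [abs_of_nonneg (Real.rpow_nonneg (hcoord x hx).1 _)]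
      exact Real.rpow_le_one (hcoord x hx).1 (hcoord x hx).2 hp0.le
    · intro α _ x hx y hy
      rw [hfl, one_mul, Nat.cast_zero, sub_zero]
      have hn : |x k - y k| ≤ ‖x - y‖ := norm_le_pi_norm (x - y) k
      rw [min_eq_left hβ1.le] at hp
      calc _ ≤ |x k - y k| ^ p :=
            abs_rpow_sub_rpow_le (hcoord x hx).1 (hcoord y hy).1 hp0.le hp1
        _ ≤ ‖x - y‖ ^ p := Real.rpow_le_rpow (abs_nonneg _) hn hp0.le
        -- Distances in the unit cube are at most `1`, so the smaller exponent gives the larger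
        -- power.
        _ ≤ ‖x - y‖ ^ β := by
            rcases (norm_nonneg (x - y)).eq_or_lt with h | h
            · rw [← h, Real.zero_rpow hp0.ne', Real.zero_rpow hβ.ne']
            · exact Real.rpow_le_rpow_of_exponent_ge h (norm_sub_le_one_of_mem_cube hx hy) hp
  · obtain rfl : p = 1 := le_antisymm hp1 (by rwa [min_eq_right hβ1] at hp)
    have hfl : 1 ≤ ⌊β⌋₊ := Nat.one_le_floor_iff _ |>.2 hβ1
    refine ⟨fun α x => if α = 0 then x k else if α = Pi.single k 1 then 1 else 0,
      ⟨fun x _ => by simp, ?_⟩, ?_, ?_⟩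
    · intro α _ j x hx
      have h1 : α + Pi.single j 1 ≠ 0 := fun h => by simpa using congrFun h j
      simp only [if_neg h1]
      by_cases hα : α = 0
      · subst hα
        simp only [if_true, zero_add]
        by_cases hjk : j = k
        · subst hjk
          simpa using! hasDerivWithinAt_id _ _
        · have h2 : (Pi.single j 1 : Fin m → ℕ) ≠ Pi.single k 1 := fun h => by
            have := congrFun h j
            simp [hjk] at this
          simp only [if_neg h2, Function.update_of_ne (Ne.symm hjk)]
          exact hasDerivWithinAt_const _ _ _
      · have h2 : α + Pi.single j 1 ≠ Pi.single k 1 := fun h => by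
          apply hα
          have h3 : ∑ l, (α + Pi.single j 1 : Fin m → ℕ) l = ∑ l, (Pi.single k 1 : Fin m → ℕ) l := by
            rw [h]
          simp only [Pi.add_apply, Finset.sum_add_distrib, Finset.sum_pi_single',
            Finset.mem_univ, if_true] at h3
          have h4 : ∑ l, α l = 0 := by omega
          ext l
          exact Finset.sum_eq_zero_iff.1 h4 l (Finset.mem_univ l)
        simp only [if_neg hα, if_neg h2]
        exact hasDerivWithinAt_const _ _ _
    · intro α _ x hx
      have := hcoord x hx
      dsimp only
      split_ifs
      · rw [abs_of_nonneg this.1]; exact this.2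
      · simp
      · simp
    · intro α hα x hx y hy
      have h0 : α ≠ 0 := fun h => by simp [h] at hα; omega
      simp only [if_neg h0, sub_self, abs_zero]
      positivity

/-! ### The bump function -/

/-- The radii `1/8` and `1/4` about `1/2` leave a margin inside `(0, 1)`, so all derivatives vanish
at the cell boundaries; compact support bounds each of them. -/
theorem exists_smooth_bump : ∃ φ : ℝ → ℝ, ContDiff ℝ (⊤ : ℕ∞) φ ∧ (∀ x, 0 ≤ φ x) ∧
    (∀ x, φ x ≤ 1) ∧ (∀ x ∈ Set.Icc (3 / 8 : ℝ) (5 / 8), φ x = 1) ∧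
    (∀ k, ∀ x ∉ Set.Ioo (0 : ℝ) 1, iteratedDeriv k φ x = 0) ∧
    ∀ k, ∃ C, ∀ x, |iteratedDeriv k φ x| ≤ C := by
  let b : ContDiffBump (1 / 2 : ℝ) := ⟨1 / 8, 1 / 4, by norm_num, by norm_num⟩
  have hsupp : ∀ k, ∀ x ∉ Set.Icc (1 / 4 : ℝ) (3 / 4), iteratedDeriv k b x = 0 := by
    intro k x hx
    by_contra h
    apply hx
    have h1 : x ∈ Function.support (iteratedFDeriv ℝ k b) := by
      rw [Function.mem_support, ← norm_ne_zero_iff, norm_iteratedFDeriv_eq_norm_iteratedDeriv]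
      exact norm_ne_zero_iff.2 h
    have h2 := support_iteratedFDeriv_subset k h1
    rw [b.tsupport_eq, Real.closedBall_eq_Icc] at h2
    convert h2 using 2 <;> norm_num [b]
  have hc : ContDiff ℝ (⊤ : ℕ∞) b := b.contDiff
  refine ⟨b, hc, fun _ => b.nonneg, fun _ => b.le_one, fun x hx => ?_, fun k x hx => ?_,
    fun k => ?_⟩
  · refine b.one_of_mem_closedBall ?_
    rw [Real.closedBall_eq_Icc]
    convert hx using 2 <;> norm_num [b]
  · refine hsupp k x fun h => hx ⟨by linarith [h.1], by linarith [h.2]⟩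
  · have hcont : Continuous (iteratedDeriv k b) :=
      hc.continuous_iteratedDeriv k (by exact_mod_cast le_top)
    obtain ⟨C, hC⟩ := isCompact_Icc.exists_bound_of_continuousOn
      (s := Set.Icc (1 / 4 : ℝ) (3 / 4)) hcont.continuousOn
    refine ⟨max C 0, fun x => ?_⟩
    by_cases hx : x ∈ Set.Icc (1 / 4 : ℝ) (3 / 4)
    · exact (hC x hx).trans (le_max_left _ _)
    · rw [hsupp k x hx, abs_zero]; exact le_max_right _ _

/-- A smooth function on `ℝ` with values in `[0, 1]`, supported in `(0, 1)` and equal to `1` on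
`[3/8, 5/8]`. -/
noncomputable def bump : ℝ → ℝ := exists_smooth_bump.choose

theorem contDiff_bump : ContDiff ℝ (⊤ : ℕ∞) bump := exists_smooth_bump.choose_spec.1
theorem bump_nonneg (x : ℝ) : 0 ≤ bump x := exists_smooth_bump.choose_spec.2.1 x
theorem bump_le_one (x : ℝ) : bump x ≤ 1 := exists_smooth_bump.choose_spec.2.2.1 x
theorem bump_eq_one {x : ℝ} (hx : x ∈ Set.Icc (3 / 8 : ℝ) (5 / 8)) : bump x = 1 :=
  exists_smooth_bump.choose_spec.2.2.2.1 x hx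
theorem iteratedDeriv_bump_eq_zero (k : ℕ) {x : ℝ} (hx : x ∉ Set.Ioo (0 : ℝ) 1) :
    iteratedDeriv k bump x = 0 := exists_smooth_bump.choose_spec.2.2.2.2.1 k x hx

theorem hasDerivAt_iteratedDeriv_bump (k : ℕ) (x : ℝ) :
    HasDerivAt (iteratedDeriv k bump) (iteratedDeriv (k + 1) bump x) x := by
  rw [iteratedDeriv_succ]
  exact ((contDiff_bump.differentiable_iteratedDeriv k
    (by exact_mod_cast WithTop.coe_lt_top k)) x).hasDerivAt

theorem exists_bound_iteratedDeriv_bump (s : ℕ) :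
    ∃ C : ℝ, 1 ≤ C ∧ ∀ k ≤ s, ∀ x, |iteratedDeriv k bump x| ≤ C := by
  choose C hC using exists_smooth_bump.choose_spec.2.2.2.2.2
  refine ⟨1 + ∑ k ∈ Finset.range (s + 1), |C k|, ?_, fun k hk x => ?_⟩
  · have : 0 ≤ ∑ k ∈ Finset.range (s + 1), |C k| := Finset.sum_nonneg fun _ _ => abs_nonneg _
    linarith
  · have h1 := Finset.single_le_sum (f := fun k => |C k|) (fun _ _ => abs_nonneg _)
      (Finset.mem_range.2 (Nat.lt_succ_of_le hk))
    have h2 : |iteratedDeriv k bump x| ≤ C k := hC k x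
    have h3 := le_abs_self (C k)
    linarith

/-- Mean value inequality for `|x - y| ≤ 1`; beyond that the trivial bound `2 * C` suffices. -/
theorem abs_iteratedDeriv_bump_sub_le {s : ℕ} {C : ℝ} (hC : 1 ≤ C)
    (hb : ∀ k ≤ s + 1, ∀ x, |iteratedDeriv k bump x| ≤ C) {θ : ℝ} (hθ : 0 ≤ θ) (hθ1 : θ ≤ 1)
    {k : ℕ} (hk : k ≤ s) (x y : ℝ) :
    |iteratedDeriv k bump x - iteratedDeriv k bump y| ≤ 2 * C * |x - y| ^ θ := by
  rcases le_total |x - y| 1 with h | h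
  · have h1 : ‖iteratedDeriv k bump x - iteratedDeriv k bump y‖ ≤ C * ‖x - y‖ :=
      convex_univ.norm_image_sub_le_of_norm_hasDerivWithin_le
        (fun z _ => (hasDerivAt_iteratedDeriv_bump k z).hasDerivWithinAt)
        (fun z _ => hb (k + 1) (by omega) z) (Set.mem_univ y) (Set.mem_univ x)
    have h2 : |x - y| ≤ |x - y| ^ θ := by
      rcases (abs_nonneg (x - y)).eq_or_lt with h0 | h0
      · rw [← h0]; positivity
      · simpa using Real.rpow_le_rpow_of_exponent_ge h0 h hθ1
    simp only [Real.norm_eq_abs] at h1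
    nlinarith [abs_nonneg (x - y)]
  · have h1 : (1 : ℝ) ≤ |x - y| ^ θ := Real.one_le_rpow h hθ
    have h2 := hb k (by omega) x
    have h3 := hb k (by omega) y
    have h4 := abs_sub (iteratedDeriv k bump x) (iteratedDeriv k bump y)
    nlinarith

theorem abs_prod_sub_prod_le {ι : Type*} (s : Finset ι) (f g : ι → ℝ) {C δ : ℝ} (hC : 1 ≤ C)
    (hδ : 0 ≤ δ) (hf : ∀ i, |f i| ≤ C) (hg : ∀ i, |g i| ≤ C) (hfg : ∀ i, |f i - g i| ≤ δ) :
    |∏ i ∈ s, f i - ∏ i ∈ s, g i| ≤ s.card * C ^ s.card * δ := by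
  classical
  induction s using Finset.induction_on with
  | empty => simp
  | insert a s ha ih =>
    rw [Finset.prod_insert ha, Finset.prod_insert ha, Finset.card_insert_of_notMem ha]
    have hP : |∏ i ∈ s, f i| ≤ C ^ s.card := by
      rw [Finset.abs_prod]
      exact (Finset.prod_le_prod (fun _ _ => abs_nonneg _) fun i _ => hf i).trans_eq (by simp)
    have e : f a * ∏ i ∈ s, f i - g a * ∏ i ∈ s, g i =
        (f a - g a) * ∏ i ∈ s, f i + g a * (∏ i ∈ s, f i - ∏ i ∈ s, g i) := by ring
    have hCn : C ^ s.card ≤ C ^ (s.card + 1) := pow_le_pow_right₀ hC (Nat.le_succ _)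
    rw [e]
    calc _ ≤ |f a - g a| * |∏ i ∈ s, f i| + |g a| * |∏ i ∈ s, f i - ∏ i ∈ s, g i| := by
          rw [← abs_mul, ← abs_mul]; exact abs_add_le _ _
      _ ≤ δ * C ^ (s.card + 1) + C * (s.card * C ^ s.card * δ) := by
          gcongr
          · exact hfg a
          · exact hP.trans hCn
          · exact hg a
      _ = _ := by push_cast; ring

/-- At most one entry of `f` and one of `g` is nonzero. This keeps the Hölder constant of a sum over
all cells independent of their number. -/
theorem sum_abs_sub_le_two_mul {U : Type*} [Fintype U] (f g : U → ℝ) {δ : ℝ} (hδ : 0 ≤ δ)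
    (hf : ∀ u v, f u ≠ 0 → f v ≠ 0 → u = v) (hg : ∀ u v, g u ≠ 0 → g v ≠ 0 → u = v)
    (h : ∀ u, |f u - g u| ≤ δ) : ∑ u, |f u - g u| ≤ 2 * δ := by
  classical
  set A := Finset.univ.filter fun u => f u ≠ 0 with hA
  set B := Finset.univ.filter fun u => g u ≠ 0 with hB
  have hA1 : A.card ≤ 1 := Finset.card_le_one.2 fun u hu v hv => hf u v (by simpa [hA] using hu)
    (by simpa [hA] using hv)
  have hB1 : B.card ≤ 1 := Finset.card_le_one.2 fun u hu v hv => hg u v (by simpa [hB] using hu)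
    (by simpa [hB] using hv)
  have hAB : (A ∪ B).card ≤ 2 := (Finset.card_union_le A B).trans (by omega)
  rw [← Finset.sum_subset (Finset.subset_univ (A ∪ B)) fun u _ hu => ?_]
  · calc _ ≤ ∑ u ∈ A ∪ B, δ := Finset.sum_le_sum fun u _ => h u
      _ = (A ∪ B).card * δ := by simp
      _ ≤ 2 * δ := by gcongr; exact_mod_cast hAB
  · simp only [hA, hB, Finset.mem_union, Finset.mem_filter, Finset.mem_univ, true_and,
      not_or, not_not] at hu
    simp [hu.1, hu.2]

/-! ### Bumps on a grid. -/

/-- The partial derivatives of the product bump on the cell `u` of the grid of width `1 / M`,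
without the factor `M ^ |α|`. -/
noncomputable def cellBump {t M : ℕ} (α : Fin t → ℕ) (u : Fin t → Fin M) (x : Fin t → ℝ) : ℝ :=
  ∏ l, iteratedDeriv (α l) bump (M * x l - (u l : ℕ))

theorem cellBump_zero {t M : ℕ} (u : Fin t → Fin M) (x : Fin t → ℝ) :
    cellBump 0 u x = ∏ l, bump (M * x l - (u l : ℕ)) := by simp [cellBump]

theorem mem_Ioo_of_cellBump_ne_zero {t M : ℕ} {α : Fin t → ℕ} {u : Fin t → Fin M}
    {x : Fin t → ℝ} (h : cellBump α u x ≠ 0) (l : Fin t) :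
    M * x l - (u l : ℕ) ∈ Set.Ioo (0 : ℝ) 1 := by
  by_contra hl
  exact h (Finset.prod_eq_zero (Finset.mem_univ l) (iteratedDeriv_bump_eq_zero _ hl))

/-- At most one integer `k` satisfies `0 < M * x l - k < 1`. -/
theorem cellBump_unique {t M : ℕ} {α : Fin t → ℕ} {u v : Fin t → Fin M} {x : Fin t → ℝ}
    (hu : cellBump α u x ≠ 0) (hv : cellBump α v x ≠ 0) : u = v := by
  funext l
  have h1 := mem_Ioo_of_cellBump_ne_zero hu l
  have h2 := mem_Ioo_of_cellBump_ne_zero hv l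
  have h3 : ((u l : ℕ) : ℝ) < (v l : ℕ) + 1 := by linarith [h1.1, h2.2]
  have h4 : ((v l : ℕ) : ℝ) < (u l : ℕ) + 1 := by linarith [h1.2, h2.1]
  have h5 : (u l : ℕ) < (v l : ℕ) + 1 := by exact_mod_cast h3
  have h6 : (v l : ℕ) < (u l : ℕ) + 1 := by exact_mod_cast h4
  exact Fin.ext (by omega)

theorem hasDerivAt_cellBump {t M : ℕ} (α : Fin t → ℕ) (u : Fin t → Fin M) (x : Fin t → ℝ)
    (j : Fin t) : HasDerivAt (fun v => cellBump α u (Function.update x j v))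
      (M * cellBump (α + Pi.single j 1) u x) (x j) := by
  have h1 : (fun v => cellBump α u (Function.update x j v)) = fun v =>
      iteratedDeriv (α j) bump (M * v - (u j : ℕ)) *
        ∏ l ∈ Finset.univ.erase j, iteratedDeriv (α l) bump (M * x l - (u l : ℕ)) := by
    funext v
    rw [cellBump, ← Finset.mul_prod_erase _ _ (Finset.mem_univ j), Function.update_self]
    congr 1
    refine Finset.prod_congr rfl fun l hl => ?_
    rw [Function.update_of_ne (Finset.ne_of_mem_erase hl)]
  have h2 : cellBump (α + Pi.single j 1) u x =
      iteratedDeriv (α j + 1) bump (M * x j - (u j : ℕ)) *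
        ∏ l ∈ Finset.univ.erase j, iteratedDeriv (α l) bump (M * x l - (u l : ℕ)) := by
    rw [cellBump, ← Finset.mul_prod_erase _ _ (Finset.mem_univ j)]
    congr 1
    · simp
    · refine Finset.prod_congr rfl fun l hl => ?_
      simp [Finset.ne_of_mem_erase hl]
  rw [h1, h2, ← mul_assoc]
  refine HasDerivAt.mul_const ?_ _
  have h3 : HasDerivAt (fun v : ℝ => M * v - (u j : ℕ)) (M : ℝ) (x j) := by
    simpa using ((hasDerivAt_id (x j)).const_mul (M : ℝ)).sub_const ((u j : ℕ) : ℝ)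
  have := (hasDerivAt_iteratedDeriv_bump (α j) (M * x j - (u j : ℕ))).comp (x j) h3
  rw [mul_comm]
  exact this

/-- The sum of the bumps on the cells `u` with `w u = true`, scaled to be `β`-Hölder. -/
noncomputable def bumpSum {t M : ℕ} (β : ℝ) (w : (Fin t → Fin M) → Bool) (x : Fin t → ℝ) : ℝ :=
  ∑ u, (if w u then 1 else 0) * ((M : ℝ) ^ (-β) * cellBump 0 u x)

/-- A derivative of order `k ≤ ⌊β⌋₊` scales like `M ^ (k - β) ≤ 1`, and in the Hölder quotient of
top order the powers of `M` cancel exactly. Since `C` does not depend on `M` or `w`, one `Q` works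
for all `n`. -/
theorem holderBound_bumpSum (t : ℕ) {β : ℝ} (hβ : 0 < β) : ∃ C : ℝ, 0 ≤ C ∧
    ∀ M : ℕ, 1 ≤ M → ∀ w : (Fin t → Fin M) → Bool, HolderBound t β C (bumpSum β w) := by
  set s := ⌊β⌋₊ with hs
  obtain ⟨C, hC, hCb⟩ := exists_bound_iteratedDeriv_bump (s + 1)
  have hsβ : (s : ℝ) ≤ β := Nat.floor_le hβ.le
  have hsβ1 : β - s ≤ 1 := by linarith [Nat.lt_floor_add_one β]
  have hC0 : 0 ≤ C := by linarith
  have hle : ∀ (α : Fin t → ℕ) (l : Fin t), ∑ l, α l ≤ s → α l ≤ s := fun α l h =>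
    (Finset.single_le_sum (f := α) (fun _ _ => Nat.zero_le _) (Finset.mem_univ l)).trans h
  -- The first entry bounds the derivatives, the second the Hölder quotients.
  refine ⟨max (2 * C ^ t) (2 * (t * C ^ t * (2 * C))), by positivity, fun M hM w => ?_⟩
  have hM1 : (1 : ℝ) ≤ M := by exact_mod_cast hM
  have hM0 : (0 : ℝ) < M := by linarith
  refine ⟨fun α x => ∑ u, (if w u then 1 else 0) *
    ((M : ℝ) ^ (-β) * ((M : ℝ) ^ (∑ l, α l) * cellBump α u x)), ⟨fun x _ => ?_, ?_⟩, ?_, ?_⟩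
  · simp [bumpSum]
  · intro α _ j x _
    refine HasDerivAt.hasDerivWithinAt ?_
    have e : ∀ u : Fin t → Fin M, (M : ℝ) ^ (∑ l, (α + Pi.single j 1 : Fin t → ℕ) l) *
        cellBump (α + Pi.single j 1) u x =
        (M : ℝ) ^ (∑ l, α l) * (M * cellBump (α + Pi.single j 1) u x) := by
      intro u
      simp only [Pi.add_apply, Finset.sum_add_distrib, Finset.sum_pi_single', Finset.mem_univ,
        if_true, pow_succ]
      ring
    simp only [e]
    refine HasDerivAt.fun_sum fun u _ => ?_
    exact (((hasDerivAt_cellBump α u x j).const_mul _).const_mul _).const_mul _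
  · intro α hα x _
    refine le_trans ?_ (le_max_left _ _)
    have hcell : ∀ u : Fin t → Fin M, |cellBump α u x| ≤ C ^ t := by
      intro u
      rw [cellBump, Finset.abs_prod]
      refine (Finset.prod_le_prod (fun _ _ => abs_nonneg _) fun l _ =>
        hCb (α l) ((hle α l hα).trans (Nat.le_succ _)) _).trans_eq (by simp)
    have hpow : (M : ℝ) ^ (-β) * (M : ℝ) ^ (∑ l, α l) ≤ 1 := by
      rw [← Real.rpow_natCast, ← Real.rpow_add hM0]
      refine Real.rpow_le_one_of_one_le_of_nonpos hM1 ?_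
      have : ((∑ l, α l : ℕ) : ℝ) ≤ s := by exact_mod_cast hα
      linarith
    calc _ ≤ ∑ u : Fin t → Fin M, |cellBump α u x| := by
          refine (Finset.abs_sum_le_sum_abs _ _).trans (Finset.sum_le_sum fun u _ => ?_)
          rw [← mul_assoc ((M : ℝ) ^ (-β)), abs_mul, abs_mul, abs_of_nonneg (a := (M : ℝ) ^ (-β) * _)
            (by positivity)]
          have : |(if w u then 1 else 0 : ℝ)| ≤ 1 := by split_ifs <;> simp
          calc _ ≤ 1 * (1 * |cellBump α u x|) := by gcongr
            _ = _ := by ring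
      _ = ∑ u : Fin t → Fin M, |cellBump α u x - 0| := by simp
      _ ≤ 2 * C ^ t := sum_abs_sub_le_two_mul _ (fun _ => 0) (by positivity)
          (fun u v => cellBump_unique) (fun u v h => absurd rfl h) (by simpa using hcell)
  · intro α hα x _ y _
    have hnn : 0 ≤ ‖x - y‖ ^ (β - (s : ℝ)) := by positivity
    refine le_trans ?_ (mul_le_mul_of_nonneg_right (le_max_right _ _) hnn)
    set δ := 2 * C * (M * ‖x - y‖) ^ (β - (s : ℝ)) with hδ
    have hδ0 : 0 ≤ δ := by positivity
    have hcell : ∀ u : Fin t → Fin M, |cellBump α u x - cellBump α u y| ≤ t * C ^ t * δ := by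
      intro u
      have := abs_prod_sub_prod_le Finset.univ
        (fun l => iteratedDeriv (α l) bump (M * x l - (u l : ℕ)))
        (fun l => iteratedDeriv (α l) bump (M * y l - (u l : ℕ))) hC hδ0
        (fun l => hCb _ ((hle α l hα.le).trans (Nat.le_succ _)) _)
        (fun l => hCb _ ((hle α l hα.le).trans (Nat.le_succ _)) _) ?_
      · simpa [cellBump] using this
      · intro l
        refine (abs_iteratedDeriv_bump_sub_le hC hCb (sub_nonneg.2 hsβ) hsβ1
          (hle α l hα.le) _ _).trans ?_
        have h1 : |M * x l - (u l : ℕ) - (M * y l - (u l : ℕ))| ≤ M * ‖x - y‖ := by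
          rw [sub_sub_sub_cancel_right, ← mul_sub, abs_mul, abs_of_pos hM0]
          gcongr
          exact norm_le_pi_norm (x - y) l
        have h0 : 0 ≤ β - s := sub_nonneg.2 hsβ
        rw [hδ]
        gcongr
    have hpow : (M : ℝ) ^ (-β) * (M : ℝ) ^ s * (M : ℝ) ^ (β - (s : ℝ)) = 1 := by
      rw [← Real.rpow_natCast, ← Real.rpow_add hM0, ← Real.rpow_add hM0]
      simp
    calc _ ≤ ∑ u, (M : ℝ) ^ (-β) * (M : ℝ) ^ s * |cellBump α u x - cellBump α u y| := by
          rw [← Finset.sum_sub_distrib]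
          refine (Finset.abs_sum_le_sum_abs _ _).trans (Finset.sum_le_sum fun u _ => ?_)
          rw [← mul_sub, ← mul_sub, ← mul_sub, hα, ← mul_assoc ((M : ℝ) ^ (-β)), abs_mul, abs_mul,
            abs_of_nonneg (a := (M : ℝ) ^ (-β) * _) (by positivity)]
          have : |(if w u then 1 else 0 : ℝ)| ≤ 1 := by split_ifs <;> simp
          exact mul_le_of_le_one_left (by positivity) this
      _ = (M : ℝ) ^ (-β) * (M : ℝ) ^ s * ∑ u, |cellBump α u x - cellBump α u y| := by
          rw [Finset.mul_sum]
      _ ≤ (M : ℝ) ^ (-β) * (M : ℝ) ^ s * (2 * (t * C ^ t * δ)) := by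
          gcongr
          exact sum_abs_sub_le_two_mul _ _ (by positivity) (fun u v => cellBump_unique)
            (fun u v => cellBump_unique) hcell
      _ = ((M : ℝ) ^ (-β) * (M : ℝ) ^ s * (M : ℝ) ^ (β - (s : ℝ))) *
            (2 * (t * C ^ t * (2 * C)) * ‖x - y‖ ^ (β - (s : ℝ))) := by
          rw [hδ, Real.mul_rpow hM0.le (norm_nonneg _)]
          ring
      _ = _ := by rw [hpow, one_mul]

/-! ### Bumps raised through the outer layers -/

theorem cellBump_zero_nonneg {t M : ℕ} (u : Fin t → Fin M) (x : Fin t → ℝ) :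
    0 ≤ cellBump 0 u x := by
  rw [cellBump_zero]
  exact Finset.prod_nonneg fun l _ => bump_nonneg _

theorem cellBump_zero_le_one {t M : ℕ} (u : Fin t → Fin M) (x : Fin t → ℝ) :
    cellBump 0 u x ≤ 1 := by
  rw [cellBump_zero]
  exact Finset.prod_le_one (fun l _ => bump_nonneg _) fun l _ => bump_le_one _

theorem bumpSum_nonneg {t M : ℕ} (β : ℝ) (w : (Fin t → Fin M) → Bool) (x : Fin t → ℝ) :
    0 ≤ bumpSum β w x := by
  refine Finset.sum_nonneg fun u _ => ?_
  have := cellBump_zero_nonneg u x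
  split_ifs <;> positivity

theorem bumpSum_eq_of_ne_zero {t M : ℕ} (β : ℝ) (w : (Fin t → Fin M) → Bool) {x : Fin t → ℝ}
    {u : Fin t → Fin M} (hu : cellBump 0 u x ≠ 0) :
    bumpSum β w x = (if w u then 1 else 0) * ((M : ℝ) ^ (-β) * cellBump 0 u x) := by
  refine Finset.sum_eq_single u (fun v _ hvu => ?_) (by simp)
  have : cellBump 0 v x = 0 := by
    by_contra hv
    exact hvu (cellBump_unique hv hu)
  simp [this]

theorem bumpSum_le {t M : ℕ} (β : ℝ) (w : (Fin t → Fin M) → Bool) (x : Fin t → ℝ) :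
    bumpSum β w x ≤ (M : ℝ) ^ (-β) := by
  have hM : 0 ≤ (M : ℝ) ^ (-β) := by positivity
  by_cases h : ∃ u : Fin t → Fin M, cellBump 0 u x ≠ 0
  · obtain ⟨u, hu⟩ := h
    rw [bumpSum_eq_of_ne_zero β w hu]
    have h0 := cellBump_zero_nonneg u x
    have h1 := cellBump_zero_le_one u x
    split_ifs
    · rw [one_mul]; exact mul_le_of_le_one_right hM h1
    · simpa
  · push Not at h
    simp [bumpSum, h, hM]

theorem bumpSum_update_mono {t M : ℕ} (β : ℝ) (w : (Fin t → Fin M) → Bool)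
    (u : Fin t → Fin M) (x : Fin t → ℝ) :
    bumpSum β (Function.update w u false) x ≤ bumpSum β (Function.update w u true) x := by
  refine Finset.sum_le_sum fun v _ => ?_
  have := cellBump_zero_nonneg v x
  refine mul_le_mul_of_nonneg_right ?_ (by positivity)
  by_cases h : v = u
  · subst h; simp
  · simp [h]

theorem bumpSum_update_eq {t M : ℕ} (β : ℝ) (w : (Fin t → Fin M) → Bool)
    {u : Fin t → Fin M} {x : Fin t → ℝ} (hu : cellBump 0 u x = 0) :
    bumpSum β (Function.update w u false) x = bumpSum β (Function.update w u true) x := by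
  refine Finset.sum_congr rfl fun v _ => ?_
  by_cases h : v = u
  · subst h; simp [hu]
  · simp [h]

theorem measurable_bumpSum {t M : ℕ} (β : ℝ) (w : (Fin t → Fin M) → Bool) :
    Measurable (bumpSum β w) := by
  have hb : Measurable bump := contDiff_bump.continuous.measurable
  unfold bumpSum
  simp only [cellBump_zero]
  fun_prop

/-! ### Membership in the class of compositions -/

/-- The index `k` of `Fin d`, or `0` if it is out of range. -/
def pick {d : ℕ} (hd : 0 < d) (k : ℕ) : Fin d := if h : k < d then ⟨k, h⟩ else ⟨0, hd⟩

theorem pick_val {d : ℕ} (hd : 0 < d) {k : ℕ} (hk : k < d) : (pick hd k : ℕ) = k := by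
  simp [pick, hk]

/-- For layers that read one coordinate although the class prescribes `t` of them: the other slots
are filled arbitrarily. -/
theorem exists_embedding_apply_eq {t d : ℕ} (ht : 0 < t) (htd : t ≤ d) (e : Fin d) :
    ∃ ι : Fin t ↪ Fin d, ι ⟨0, ht⟩ = e :=
  ⟨(Fin.castLEEmb htd).trans (Equiv.swap (Fin.castLE htd ⟨0, ht⟩) e).toEmbedding, by simp⟩

theorem mem_cube {m : ℕ} {a b : ℝ} {x : Fin m → ℝ} :
    x ∈ cube m a b ↔ ∀ l, a ≤ x l ∧ x l ≤ b :=
  ⟨fun h l => ⟨h.1 l, h.2 l⟩, fun h => ⟨fun l => (h l).1, fun l => (h l).2⟩⟩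

section Layers

variable {r : ℕ} {d : Fin (r + 2) → ℕ} {t : Fin (r + 1) → ℕ} {β : Fin (r + 1) → ℝ}

/-- Layers that compute `a + b * f ^ ∏_{l > i} min (β_l, 1)`: coordinates before layer `i`, the
function `f` in layer `i`, powers after it, and an affine map at the end. -/
noncomputable def powerLayers (hd : ∀ l, 0 < d l) (β : Fin (r + 1) → ℝ) (i : Fin (r + 1))
    (f : (Fin (t i) → ℝ) → ℝ) (a b : ℝ) (l : Fin (r + 1)) (x : Fin (d l.castSucc) → ℝ)
    (j : Fin (d l.succ)) : ℝ :=
  (if l.succ = Fin.last (r + 1) then a else 0) + (if l.succ = Fin.last (r + 1) then b else 1) *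
    if l = i then f (fun k => x (pick (hd _) k))
    else x (pick (hd _) j) ^ (if l < i then 1 else min (β l) 1)

theorem compLayers_succ (g : (i : Fin (r + 1)) → (Fin (d i.castSucc) → ℝ) → (Fin (d i.succ) → ℝ))
    (x : Fin (d 0) → ℝ) (l : Fin (r + 1)) :
    compLayers g x l.succ = g l (compLayers g x l.castSucc) := rfl

/-- Up to layer `i` only the first `t i` coordinates must survive, and every width there has room
for them. After it all coordinates carry the same value, so the default index of `pick` does no harm
and the exponents multiply. -/
theorem compLayers_powerLayers (hd : ∀ l, 0 < d l) (i : Fin (r + 1))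
    (hdt : ∀ l : Fin (r + 2), l.val ≤ i.val → t i ≤ d l)
    (f : (Fin (t i) → ℝ) → ℝ) (hf : ∀ z, 0 ≤ f z) (a b : ℝ) (x : Fin (d 0) → ℝ)
    (L : Fin (r + 2)) :
    (L.val ≤ i.val → ∀ k < t i, compLayers (powerLayers hd β i f a b) x L (pick (hd L) k) =
      x (pick (hd 0) k)) ∧
    (i.val < L.val → ∀ j, compLayers (powerLayers hd β i f a b) x L j =
      (if L = Fin.last (r + 1) then a else 0) + (if L = Fin.last (r + 1) then b else 1) *
        f (fun k => x (pick (hd 0) k)) ^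
          ∏ l ∈ Finset.univ.filter (fun l : Fin (r + 1) => i < l ∧ l.val < L.val),
            min (β l) 1) := by
  induction L using Fin.induction with
  | zero => exact ⟨fun _ k _ => rfl, fun h => absurd h (by simp)⟩
  | succ l ih =>
    obtain ⟨ih1, ih2⟩ := ih
    simp only [compLayers_succ]
    refine ⟨fun hl k hk => ?_, fun hl j => ?_⟩
    · simp only [Fin.val_succ] at hl
      have h1 : l < i := Fin.lt_def.2 (by omega)
      have h2 : l.succ ≠ Fin.last (r + 1) := fun h => by
        have := congrArg Fin.val h
        simp only [Fin.val_succ, Fin.val_last] at this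
        omega
      have hk' : k < d l.succ := hk.trans_le (hdt _ (by simpa using hl))
      simp only [powerLayers, if_neg h2, if_neg h1.ne, if_pos h1, zero_add, one_mul,
        Real.rpow_one, pick_val _ hk']
      exact ih1 (by simp only [Fin.val_castSucc]; omega) k hk
    · simp only [Fin.val_succ] at hl
      rw [powerLayers]
      congr 2
      by_cases hli : l = i
      · subst hli
        rw [if_pos rfl]
        have : Finset.univ.filter (fun l' : Fin (r + 1) => l < l' ∧ l'.val < l.succ.val) = ∅ := by
          ext l'
          simp only [Fin.lt_def, Fin.val_succ, Finset.mem_filter, Finset.mem_univ, true_and,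
            Finset.notMem_empty, iff_false]
          omega
        rw [this, Finset.prod_empty, Real.rpow_one]
        congr 1
        funext k
        exact ih1 le_rfl k k.2
      · have hil : i < l := by
          rw [Fin.lt_def]
          have : l.val ≠ i.val := fun h => hli (Fin.ext h)
          omega
        have h2 : l.castSucc ≠ Fin.last (r + 1) := (Fin.castSucc_lt_last l).ne
        rw [if_neg hli, if_neg hil.asymm, ih2 hil, if_neg h2, if_neg h2, zero_add, one_mul,
          ← Real.rpow_mul (hf _)]
        congr 1
        have hfil : Finset.univ.filter (fun l' : Fin (r + 1) => i < l' ∧ l'.val < l.succ.val) =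
            insert l (Finset.univ.filter
              fun l' : Fin (r + 1) => i < l' ∧ l'.val < l.castSucc.val) := by
          ext l'
          simp only [Fin.lt_def, Fin.val_succ, Finset.mem_filter, Finset.mem_univ, true_and,
            Finset.mem_insert, Fin.ext_iff, Fin.val_castSucc] at hil ⊢
          omega
        rw [hfil, Finset.prod_insert (by simp), mul_comm]

/-- All intermediate intervals are `[0, 1]`. The affine map is absorbed into the last layer, at the
price of `C + 1` for `C`; `1 ≤ C` lets the same constant cover the power layers. -/
theorem affine_rpow_mem_compClass (hd : ∀ l, 0 < d l) (ht : ∀ i, 1 ≤ t i)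
    (htd : ∀ i j : Fin (r + 1), j ≤ i → t i ≤ d j.castSucc) (hβ : ∀ i, 0 < β i)
    (i : Fin (r + 1)) {f : (Fin (t i) → ℝ) → ℝ} {C Q : ℝ} (hC : 1 ≤ C)
    (hf : HolderBound (t i) (β i) C f) (hf0 : ∀ z, 0 ≤ f z) (hf1 : ∀ z, f z ≤ 1) {a b : ℝ}
    (ha : |a| ≤ 1) (hb : |b| ≤ 1) (hab : ∀ v, 0 ≤ v → v ≤ 1 → 0 ≤ a + b * v ∧ a + b * v ≤ 1)
    (hQ1 : 1 ≤ Q) (hQ : ∀ l, holderTerms (t l) (β l) * (C + 1) ≤ Q) :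
    (fun x => a + b * f (fun k => x (pick (hd 0) k)) ^ ∏ l ∈ Finset.Ioi i, min (β l) 1) ∈
      compClass r d t β Q := by
  refine ⟨fun _ => 0, fun _ => 1, powerLayers hd β i f a b, rfl, rfl,
    fun _ => ⟨by simpa using zero_le_one.trans hQ1, by simpa using hQ1⟩,
    fun l x hx => ?_, fun l j => ?_, fun x _ => ?_⟩
  · rw [mem_cube] at hx ⊢
    intro j
    have hexp : 0 ≤ (if l < i then 1 else min (β l) 1 : ℝ) := by
      have := hβ l
      split_ifs <;> positivity
    have hv : ∀ v : ℝ, 0 ≤ v → v ≤ 1 → 0 ≤ (if l.succ = Fin.last (r + 1) then a else 0) +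
        (if l.succ = Fin.last (r + 1) then b else 1) * v ∧
        (if l.succ = Fin.last (r + 1) then a else 0) +
        (if l.succ = Fin.last (r + 1) then b else 1) * v ≤ 1 := by
      intro v h0 h1
      split_ifs
      · exact hab v h0 h1
      · simpa using ⟨h0, h1⟩
    refine hv _ ?_ ?_ <;> split
    exacts [hf0 _, Real.rpow_nonneg (hx _).1 _, hf1 _, Real.rpow_le_one (hx _).1 (hx _).2 hexp]
  · set A := if l.succ = Fin.last (r + 1) then a else 0 with hA
    set B := if l.succ = Fin.last (r + 1) then b else 1 with hB
    have hA1 : |A| ≤ 1 := by rw [hA]; split_ifs <;> simp [ha]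
    have hB1 : |B| ≤ 1 := by rw [hB]; split_ifs <;> simp [hb]
    by_cases hli : l = i
    · subst hli
      refine ⟨Fin.castLEEmb (htd l l le_rfl), fun z => A + B * f z,
        (hf.affine hA1 hB1).mem_holderBall (hQ l), fun x _ => ?_⟩
      simp only [powerLayers, if_true]
      congr 3
      funext k
      have : pick (hd l.castSucc) k = Fin.castLE (htd l l le_rfl) k :=
        Fin.ext (pick_val _ (k.2.trans_le (htd l l le_rfl)))
      rw [this]
      rfl
    · obtain ⟨ι, hι⟩ := exists_embedding_apply_eq (ht l) (htd l l le_rfl)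
        (pick (hd l.castSucc) j)
      have hp : min (β l) 1 ≤ (if l < i then 1 else min (β l) 1 : ℝ) := by
        split_ifs
        · exact min_le_right _ _
        · exact le_rfl
      have hp1 : (if l < i then 1 else min (β l) 1 : ℝ) ≤ 1 := by
        split_ifs
        · exact le_rfl
        · exact min_le_right _ _
      refine ⟨ι, fun z => A + B * z ⟨0, ht l⟩ ^ (if l < i then 1 else min (β l) 1 : ℝ),
        ((holderBound_coord_rpow (hβ l) hp hp1 _).affine hA1 hB1).mem_holderBall
          (le_trans ?_ (hQ l)), fun x _ => ?_⟩
      · gcongr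
      · simp only [powerLayers, if_neg hli, Function.comp_apply, hι]
        rfl
  · funext j
    have hdt : ∀ l : Fin (r + 2), l.val ≤ i.val → t i ≤ d l := by
      intro l hl
      have := htd i ⟨l.val, by omega⟩ (Fin.le_def.2 hl)
      exact this
    rw [(compLayers_powerLayers hd i hdt f hf0 a b x (Fin.last (r + 1))).2 i.2 j,
      if_pos rfl, if_pos rfl]
    congr 3
    refine Finset.prod_congr ?_ fun _ _ => rfl
    ext l
    simpa using fun _ => Nat.le_of_lt_succ l.2

theorem twoLabel_mem_condProbClass {K : ℕ} (hK : 2 ≤ K) (hd : ∀ l, 0 < d l) (ht : ∀ i, 1 ≤ t i)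
    (htd : ∀ i j : Fin (r + 1), j ≤ i → t i ≤ d j.castSucc) (hβ : ∀ i, 0 < β i)
    (i : Fin (r + 1)) {f : (Fin (t i) → ℝ) → ℝ} {C Q : ℝ} (hC : 1 ≤ C)
    (hf : HolderBound (t i) (β i) C f) (hf0 : ∀ z, 0 ≤ f z) (hf1 : ∀ z, f z ≤ 1)
    (hQ1 : 1 ≤ Q) (hQ : ∀ l, holderTerms (t l) (β l) * (C + 1) ≤ Q)
    {F : (Fin (d 0) → ℝ) → ℝ}
    (hF : F = fun x => f (fun k => x (pick (hd 0) k)) ^ ∏ l ∈ Finset.Ioi i, min (β l) 1) :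
    twoLabel K F (fun x => 1 - F x) ∈ condProbClass r d t β Q K := by
  have hB : 0 ≤ ∏ l ∈ Finset.Ioi i, min (β l) 1 :=
    Finset.prod_nonneg fun l _ => (lt_min (hβ l) one_pos).le
  have hF0 : ∀ x, 0 ≤ F x := fun x => by rw [hF]; exact Real.rpow_nonneg (hf0 _) _
  have hF1 : ∀ x, F x ≤ 1 := fun x => by rw [hF]; exact Real.rpow_le_one (hf0 _) (hf1 _) hB
  refine ⟨fun x _ => ⟨fun k => ?_, ?_⟩, fun k => ?_⟩
  · have := hF0 x
    have := hF1 x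
    unfold twoLabel
    split_ifs <;> linarith
  · obtain ⟨K, rfl⟩ : ∃ L, K = L + 2 := ⟨K - 2, by omega⟩
    rw [Fin.sum_univ_succ, Fin.sum_univ_succ]
    simp [twoLabel]
  · have key := fun (a b : ℝ) (ha : |a| ≤ 1) (hb : |b| ≤ 1)
      (hab : ∀ v, 0 ≤ v → v ≤ 1 → 0 ≤ a + b * v ∧ a + b * v ≤ 1) =>
      affine_rpow_mem_compClass hd ht htd hβ i hC hf hf0 hf1 ha hb hab hQ1 hQ
    unfold twoLabel
    split_ifs
    · convert key 0 1 (by simp) (by simp) (fun v h0 h1 => by constructor <;> linarith) using 2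
      simp [hF]
    · convert key 1 (-1) (by simp) (by simp) (fun v h0 h1 => by constructor <;> linarith) using 2
      simp [hF, sub_eq_add_neg]
    · convert key 0 0 (by simp) (by simp) (fun v h0 h1 => by constructor <;> linarith) using 2
      simp

end Layers

/-! ### Cells -/

/-- The points whose first `t` coordinates lie between the relative positions `p` and `q` in the
cell `u` of the grid of width `1 / M`. -/
def cell {t M m : ℕ} (hm : 0 < m) (p q : ℝ) (u : Fin t → Fin M) : Set (Fin m → ℝ) :=
  {x | ∀ k : Fin t, M * x (pick hm k) - (u k : ℕ) ∈ Set.Icc p q}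

theorem measurableSet_cell {t M m : ℕ} (hm : 0 < m) (p q : ℝ) (u : Fin t → Fin M) :
    MeasurableSet (cell hm p q u) := by
  unfold cell
  simp only [Set.ofPred_forall]
  refine MeasurableSet.iInter fun k => ?_
  exact (by fun_prop : Measurable fun x : Fin m → ℝ => M * x (pick hm k) - ((u k : ℕ) : ℝ))
    measurableSet_Icc

/-- In the cube the cell is a box with `t` sides of length `(q - p) / M` and unit sides otherwise;
`0 ≤ p` and `q ≤ 1` keep the short sides inside `[0, 1]`. -/
theorem volume_cell {t M m : ℕ} (hm : 0 < m) (htm : t ≤ m) (hM : 1 ≤ M) {p q : ℝ} (hp : 0 ≤ p)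
    (hq : q ≤ 1) (u : Fin t → Fin M) :
    volume (cell hm p q u ∩ cube m 0 1) = ENNReal.ofReal ((q - p) / M) ^ t := by
  have hM0 : (0 : ℝ) < M := by exact_mod_cast hM
  have hset : cell hm p q u ∩ cube m 0 1 = Set.pi Set.univ fun j : Fin m =>
      if h : j.val < t then Set.Icc (((u ⟨j, h⟩ : ℕ) + p) / M) (((u ⟨j, h⟩ : ℕ) + q) / M)
      else Set.Icc (0 : ℝ) 1 := by
    ext x
    simp only [cell, Set.mem_inter_iff, Set.mem_ofPred_eq, mem_cube, Set.mem_pi, Set.mem_univ,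
      true_implies]
    have hiff : ∀ (y : ℝ) (v : ℕ), M * y - v ∈ Set.Icc p q ↔
        y ∈ Set.Icc ((v + p) / M) ((v + q) / M) := by
      intro y v
      rw [Set.mem_Icc, Set.mem_Icc, div_le_iff₀ hM0, le_div_iff₀ hM0]
      constructor <;> rintro ⟨h1, h2⟩ <;> constructor <;> linarith
    constructor
    · rintro ⟨h1, h2⟩ j
      split_ifs with hj
      · have := h1 ⟨j, hj⟩
        rw [show pick hm j = j from Fin.ext (pick_val hm j.2)] at this
        exact (hiff _ _).1 this
      · exact h2 j
    · intro h
      refine ⟨fun k => ?_, fun j => ?_⟩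
      · have hk := pick_val hm (k.2.trans_le htm)
        have := h (pick hm k)
        rw [dif_pos (by rw [hk]; exact k.2)] at this
        rw [hiff]
        simpa only [hk] using this
      · have := h j
        split_ifs at this with hj
        · rw [← hiff] at this
          have hu : ((u ⟨j, hj⟩ : ℕ) : ℝ) + 1 ≤ M := by exact_mod_cast (u ⟨j, hj⟩).2
          have hu0 : (0 : ℝ) ≤ (u ⟨j, hj⟩ : ℕ) := Nat.cast_nonneg _
          constructor
          · have : 0 ≤ M * x j := by linarith [this.1]
            exact nonneg_of_mul_nonneg_right this hM0
          · have : M * x j ≤ M * 1 := by linarith [this.2]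
            exact le_of_mul_le_mul_left this hM0
        · exact this
  rw [hset, volume_pi_pi]
  have hvol : ∀ j : Fin m, volume (if h : j.val < t then
      Set.Icc (((u ⟨j, h⟩ : ℕ) + p) / M) (((u ⟨j, h⟩ : ℕ) + q) / M) else Set.Icc (0 : ℝ) 1) =
      if j.val < t then ENNReal.ofReal ((q - p) / M) else 1 := by
    intro j
    split_ifs
    · rw [Real.volume_Icc]; congr 1; ring
    · simp
  simp only [hvol]
  rw [Finset.prod_ite, Finset.prod_const, Finset.prod_const_one, mul_one]
  congr 1
  rw [Fin.card_filter_val_lt]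
  exact min_eq_right htm

theorem HasDensityBetween.measure_le {m : ℕ} {PX : Measure (Fin m → ℝ)} {γ Γ : ℝ}
    (h : HasDensityBetween PX γ Γ) {s : Set (Fin m → ℝ)} (hs : MeasurableSet s) :
    PX s ≤ ENNReal.ofReal Γ * volume (s ∩ cube m 0 1) ∧
      ENNReal.ofReal γ * volume (s ∩ cube m 0 1) ≤ PX s := by
  obtain ⟨-, q, -, hq, rfl⟩ := h
  have hsc : MeasurableSet (s ∩ cube m 0 1) := hs.inter measurableSet_Icc
  rw [withDensity_apply _ hs, Measure.restrict_restrict hs, ← setLIntegral_const,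
    ← setLIntegral_const]
  exact ⟨setLIntegral_mono' hsc fun x hx => ENNReal.ofReal_le_ofReal (hq x hx.2).2,
    setLIntegral_mono' hsc fun x hx => ENNReal.ofReal_le_ofReal (hq x hx.2).1⟩

/-- Evaluate the density bounds at the origin; this yields `0 < Γ` later. -/
theorem HasDensityBetween.le {m : ℕ} {PX : Measure (Fin m → ℝ)} {γ Γ : ℝ}
    (h : HasDensityBetween PX γ Γ) : γ ≤ Γ := by
  obtain ⟨-, q, -, hq, -⟩ := h
  have := hq 0 (mem_cube.2 fun _ => by simp)
  exact this.1.trans this.2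

/-! ### The lower bound -/

section Main

variable {r : ℕ} {d : Fin (r + 2) → ℕ} {t : Fin (r + 1) → ℕ} {β : Fin (r + 1) → ℝ}

/-- The bound from the grid of width `1 / M` in layer `i`. -/
theorem le_minimaxRisk_of_grid {K : ℕ} (hK : 2 ≤ K) (hd : ∀ l, 0 < d l) (ht : ∀ i, 1 ≤ t i)
    (htd : ∀ i j : Fin (r + 1), j ≤ i → t i ≤ d j.castSucc) (hβ : ∀ i, 0 < β i)
    (i : Fin (r + 1)) {C Q : ℝ} (hC : 1 ≤ C) {M : ℕ} (hM : 1 ≤ M)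
    (hf : ∀ w : (Fin (t i) → Fin M) → Bool, HolderBound (t i) (β i) C (bumpSum (β i) w))
    (hQ1 : 1 ≤ Q) (hQ : ∀ l, holderTerms (t l) (β l) * (C + 1) ≤ Q) {γ Γ : ℝ} (hγ : 0 < γ)
    {PX : Measure (Fin (d 0) → ℝ)} (hPX : HasDensityBetween PX γ Γ) {n : ℕ} (hn : 1 ≤ n)
    (hnM : n * ((M : ℝ) ^ (-effSmoothness β i) * (Γ * (1 / M) ^ t i)) ≤ 1 / 2) :
    ENNReal.ofReal (γ * (1 / 4) ^ t i / 16 * (M : ℝ) ^ (-effSmoothness β i)) ≤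
      minimaxRisk PX (condProbClass r d t β Q K) n := by
  have : IsProbabilityMeasure PX := hPX.1
  have hM0 : (0 : ℝ) < M := by exact_mod_cast hM
  have hΓ : 0 < Γ := hγ.trans_le hPX.le
  set B := ∏ l ∈ Finset.Ioi i, min (β l) 1 with hBdef
  have hB : 0 < B := Finset.prod_pos fun l _ => lt_min (hβ l) one_pos
  have hε : ((M : ℝ) ^ (-β i)) ^ B = (M : ℝ) ^ (-effSmoothness β i) := by
    rw [← Real.rpow_mul hM0.le, effSmoothness, neg_mul]
  have heff : 0 ≤ effSmoothness β i := mul_nonneg (hβ i).le hB.le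
  have hMβ : (M : ℝ) ^ (-β i) ≤ 1 :=
    Real.rpow_le_one_of_one_le_of_nonpos (by exact_mod_cast hM) (by linarith [hβ i])
  have htd0 : t i ≤ d 0 := htd i 0 (Fin.zero_le _)
  have hcell0 : ∀ (u : Fin (t i) → Fin M) (x : Fin (d 0) → ℝ), x ∉ cell (hd 0) 0 1 u →
      cellBump 0 u (fun k => x (pick (hd 0) k)) = 0 := by
    intro u x hx
    by_contra h
    exact hx fun k => Set.Ioo_subset_Icc_self (mem_Ioo_of_cellBump_ne_zero h k)
  have hcell1 : ∀ (u : Fin (t i) → Fin M) (x : Fin (d 0) → ℝ),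
      x ∈ cell (hd 0) (3 / 8) (5 / 8) u →
      cellBump 0 u (fun k => x (pick (hd 0) k)) = 1 := by
    intro u x hx
    rw [cellBump_zero]
    exact Finset.prod_eq_one fun k _ => bump_eq_one (hx k)
  -- A bump can be nonzero only on its full cell (`C`) and equals `1` on the core between `3/8` and
  -- `5/8` (`I`), whence the factor `1/4` in `δ`.
  have main := le_minimaxRisk_of_cells (n := n) hK PX
    (fun w x => bumpSum (β i) w (fun k => x (pick (hd 0) k)) ^ B)
    (fun u : Fin (t i) → Fin M => cell (hd 0) 0 1 u)
    (fun u => cell (hd 0) (3 / 8) (5 / 8) u)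
    (ε := (M : ℝ) ^ (-effSmoothness β i)) (δ := γ * (1 / 4 / M) ^ t i)
    (κ := Γ * (1 / M) ^ t i) (by positivity)
    (Real.rpow_le_one_of_one_le_of_nonpos (by exact_mod_cast hM) (by linarith))
    (by positivity) (by positivity)
    (fun w => by
      have := measurable_bumpSum (β i) w
      fun_prop)
    (fun w x => Real.rpow_nonneg (bumpSum_nonneg _ _ _) _)
    (fun w x => by
      rw [← hε]
      exact Real.rpow_le_rpow (bumpSum_nonneg _ _ _) (bumpSum_le _ _ _) hB.le)
    (fun w u x => Real.rpow_le_rpow (bumpSum_nonneg _ _ _) (bumpSum_update_mono _ _ _ _) hB.le)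
    (fun w u x hx => congrArg (· ^ B) (bumpSum_update_eq _ _ (hcell0 u x hx)))
    (fun w u x hx => by
      rw [bumpSum_eq_of_ne_zero (u := u) _ _ (by rw [hcell1 u x hx]; exact one_ne_zero),
        hcell1 u x hx]
      split_ifs
      · rw [one_mul, mul_one, hε]
      · rw [zero_mul, Real.zero_rpow hB.ne'])
    (fun u => measurableSet_cell _ _ _ _) (fun u => measurableSet_cell _ _ _ _)
    (fun u v huv => Set.disjoint_left.2 fun x hu hv => huv (cellBump_unique
      (by rw [hcell1 u x hu]; exact one_ne_zero) (by rw [hcell1 v x hv]; exact one_ne_zero)))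
    (fun u => by
      refine (hPX.measure_le (measurableSet_cell _ _ _ u)).1.trans_eq ?_
      rw [volume_cell (hd 0) htd0 hM le_rfl le_rfl, sub_zero, ENNReal.ofReal_mul hΓ.le,
        ENNReal.ofReal_pow (by positivity)])
    (fun u => by
      refine Eq.trans_le ?_ (hPX.measure_le (measurableSet_cell _ _ _ u)).2
      rw [volume_cell (hd 0) htd0 hM (by norm_num) (by norm_num), ENNReal.ofReal_mul hγ.le,
        ENNReal.ofReal_pow (by positivity)]
      norm_num)
    hnM hn (condProbClass r d t β Q K)
    (fun w => twoLabel_mem_condProbClass hK hd ht htd hβ i hC (hf w) (bumpSum_nonneg _ _)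
      (fun z => (bumpSum_le _ _ _).trans hMβ) hQ1 hQ rfl)
  refine le_trans (ENNReal.ofReal_le_ofReal (le_of_eq ?_)) main
  -- The number `M ^ t i` of cells cancels the volume factor `M ^ (-t i)` in `δ`.
  simp only [Fintype.card_pi, Fintype.card_fin, Finset.prod_const, Finset.card_univ]
  rw [div_pow (1 / 4 : ℝ)]
  push_cast
  field_simp

theorem exists_lowerBound_layer {K : ℕ} (hK : 2 ≤ K) (hd : ∀ l, 0 < d l) (ht : ∀ i, 1 ≤ t i)
    (htd : ∀ i j : Fin (r + 1), j ≤ i → t i ≤ d j.castSucc) (hβ : ∀ i, 0 < β i)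
    (i : Fin (r + 1)) : ∃ Q₀ : ℝ, 0 < Q₀ ∧ ∀ Q : ℝ, Q₀ ≤ Q → ∀ γ Γ : ℝ, 0 < γ →
      ∃ c : ℝ, 0 < c ∧ ∀ PX : Measure (Fin (d 0) → ℝ), HasDensityBetween PX γ Γ →
        ∀ n : ℕ, 1 ≤ n →
          ENNReal.ofReal (c * (n : ℝ) ^ (-(effSmoothness β i / (effSmoothness β i + t i)))) ≤
            minimaxRisk PX (condProbClass r d t β Q K) n := by
  obtain ⟨C, hC, hCb⟩ := holderBound_bumpSum (t i) (hβ i)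
  have hsum : 0 ≤ ∑ l, (holderTerms (t l) (β l) : ℝ) * (C + 1 + 1) :=
    Finset.sum_nonneg fun l _ => by positivity
  -- One `+ 1` makes the Hölder constant at least `1`, the other pays for the affine map; the
  -- leading `1` admits the interval endpoints.
  refine ⟨1 + ∑ l, (holderTerms (t l) (β l) : ℝ) * (C + 1 + 1), by linarith,
    fun Q hQ γ Γ hγ => ?_⟩
  have hQl : ∀ l, (holderTerms (t l) (β l) : ℝ) * (C + 1 + 1) ≤ Q := fun l => by
    have := Finset.single_le_sum (f := fun l => (holderTerms (t l) (β l) : ℝ) * (C + 1 + 1))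
      (fun l _ => by positivity) (Finset.mem_univ l)
    linarith
  set s := effSmoothness β i with hs
  have hs0 : 0 < s := mul_pos (hβ i) (Finset.prod_pos fun l _ => lt_min (hβ l) one_pos)
  set ρ := s + t i with hρ
  have hρ0 : 0 < ρ := by positivity
  -- `A ≥ 1` ensures `X ≥ 1`; `A ≥ 2 * Γ` yields the bound `Γ / A ≤ 1 / 2` on `n * (ε * κ)`.
  set A := max 1 (2 * Γ) with hA
  have hA1 : 1 ≤ A := le_max_left _ _
  have hA0 : 0 < A := by linarith
  refine ⟨γ * (1 / 4) ^ t i / 16 * (2 ^ (-s) * A ^ (-(s / ρ))), by positivity,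
    fun PX hPX n hn => ?_⟩
  have hn1 : (1 : ℝ) ≤ n := by exact_mod_cast hn
  have hAn : 1 ≤ A * n := one_le_mul_of_one_le_of_one_le hA1 hn1
  set X := (A * n) ^ (1 / ρ) with hX
  have hX1 : 1 ≤ X := Real.one_le_rpow hAn (by positivity)
  set M := ⌈X⌉₊ with hM
  have hXM : X ≤ M := Nat.le_ceil X
  -- Rounding up at most doubles `X ≥ 1`, whence `2 ^ (-s)` in the constant.
  have hMX : (M : ℝ) ≤ 2 * X := by linarith [Nat.ceil_lt_add_one (zero_le_one.trans hX1)]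
  have hM1 : (1 : ℝ) ≤ M := hX1.trans hXM
  have hM0 : (0 : ℝ) < M := by linarith
  have hΓ : 0 < Γ := hγ.trans_le hPX.le
  have hC1 : ∀ w : (Fin (t i) → Fin M) → Bool,
      HolderBound (t i) (β i) (C + 1) (bumpSum (β i) w) := fun w => by
    simpa using (hCb M (by exact_mod_cast hM1) w).affine (a := 0) (b := 1) (by simp) (by simp)
  refine le_trans (ENNReal.ofReal_le_ofReal ?_) (le_minimaxRisk_of_grid hK hd ht htd hβ i
    (C := C + 1) (by linarith) (by exact_mod_cast hM1) hC1 (by linarith) hQl hγ hPX hn ?_)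
  · rw [mul_assoc]
    refine mul_le_mul_of_nonneg_left ?_ (by positivity)
    calc 2 ^ (-s) * A ^ (-(s / ρ)) * (n : ℝ) ^ (-(s / ρ)) = (2 * X) ^ (-s) := by
          rw [Real.mul_rpow (by norm_num) (by linarith), mul_assoc,
            ← Real.mul_rpow hA0.le (by linarith), hX, ← Real.rpow_mul (by linarith)]
          congr 2
          ring
      _ ≤ (M : ℝ) ^ (-s) := Real.rpow_le_rpow_of_nonpos hM0 hMX (by linarith)
  · have e : (M : ℝ) ^ (-s) * (Γ * (1 / M) ^ t i) = Γ * (M : ℝ) ^ (-ρ) := by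
      rw [hρ, neg_add, Real.rpow_add hM0, Real.rpow_neg hM0.le (t i : ℝ), Real.rpow_natCast,
        one_div, inv_pow]
      ring
    have h1 : (M : ℝ) ^ (-ρ) ≤ (A * n)⁻¹ := by
      calc (M : ℝ) ^ (-ρ) ≤ X ^ (-ρ) :=
            Real.rpow_le_rpow_of_nonpos (by linarith) hXM (by linarith)
        _ = (A * n)⁻¹ := by
            rw [hX, ← Real.rpow_mul (by linarith), ← Real.rpow_neg_one]
            congr 1
            field_simp
    rw [e]
    calc (n : ℝ) * (Γ * (M : ℝ) ^ (-ρ)) ≤ n * (Γ * (A * n)⁻¹) := by gcongr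
      _ = Γ / A := by field_simp
      _ ≤ 1 / 2 := by
          rw [div_le_iff₀ hA0]
          linarith [le_max_right 1 (2 * Γ)]

end Main

end CompositeClassification

theorem mainTheorem3 (r K : ℕ) (hK : 2 ≤ K) (d : Fin (r + 2) → ℕ) (t : Fin (r + 1) → ℕ)
    (β : Fin (r + 1) → ℝ) (hlast : d (Fin.last (r + 1)) = 1) (ht : ∀ i, 1 ≤ t i)
    (htd : ∀ i j : Fin (r + 1), j ≤ i → t i ≤ d j.castSucc) (hβ : ∀ i, 0 < β i) :
    ∃ Q₀ : ℝ, 0 < Q₀ ∧ ∀ Q : ℝ, Q₀ ≤ Q → ∀ γ Γ : ℝ, 0 < γ →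
      ∃ c : ℝ, 0 < c ∧ ∀ PX : Measure (Fin (d 0) → ℝ),
        CompositeClassification.HasDensityBetween PX γ Γ → ∀ n : ℕ, 1 ≤ n →
          ENNReal.ofReal (c * CompositeClassification.rate t β n) ≤
            CompositeClassification.minimaxRisk PX
              (CompositeClassification.condProbClass r d t β Q K) n := by
  have hd : ∀ l, 0 < d l := by
    intro l
    induction l using Fin.lastCases with
    | last => rw [hlast]; exact one_pos
    | cast l => exact (ht l).trans (htd l l le_rfl)
  choose Q₀ hQ₀ H using
    fun i => CompositeClassification.exists_lowerBound_layer hK hd ht htd hβ i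
  refine ⟨Finset.univ.sup' Finset.univ_nonempty Q₀,
    (hQ₀ 0).trans_le (Finset.le_sup' Q₀ (Finset.mem_univ 0)), fun Q hQ γ Γ hγ => ?_⟩
  choose c hc Hc using
    fun i => H i Q ((Finset.le_sup' Q₀ (Finset.mem_univ i)).trans hQ) γ Γ hγ
  refine ⟨Finset.univ.inf' Finset.univ_nonempty c, (Finset.lt_inf'_iff _).2 fun i _ => hc i,
    fun PX hPX n hn => ?_⟩
  -- The bound of a layer attaining the maximum in the rate is enough.
  obtain ⟨i, -, hi⟩ := Finset.exists_mem_eq_sup' Finset.univ_nonempty fun i : Fin (r + 1) =>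
    (n : ℝ) ^ (-(CompositeClassification.effSmoothness β i /
      (CompositeClassification.effSmoothness β i + t i)))
  refine le_trans (ENNReal.ofReal_le_ofReal ?_) (Hc i PX hPX n hn)
  rw [CompositeClassification.rate, hi]
  exact mul_le_mul_of_nonneg_right (Finset.inf'_le c (Finset.mem_univ i)) (by positivity)
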